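/- Let $d\ge 1$. For each $i\in\{1,\dots,d\}$ let $\Phi_i=(\phi_{i,a})_{a\in A_i}$ be a finite collection of contracting similarities of $[0,1]$ (maps $x\mapsto \rho x+t$ with $0<|\rho|<1$ sending $[0,1]$ into itself). Let $\mathcal D\subset\prod_i A_i$ be nonempty, and for $\mathbf a=(a_1,\dots,a_d)\in\mathcal D$ put $\phi_{\mathbf a}(x_1,\dots,x_d)=(\phi_{\mathbf a,1}(x_1),\dots,\phi_{\mathbf a,d}(x_d))$ with $\phi_{\mathbf a,i}=\phi_{i,a_i}$. Let $\Phi=(\phi_{\mathbf a})_{\mathbf a\in\mathcal D}$ and let $\Lambda_\Phi\subset\mathbb R^d$ be the unique nonempty compact set with $\Lambda_\Phi=\bigcup_{\mathbf a\in\mathcal D}\phi_{\mathbf a}(\Lambda_\Phi)$ (a diagonal self-affine sponge). Assume: (Coordinate ordering condition) there is a permutation $\sigma$ of $\{1,\dots,d\}$ with $|\phi'_{\mathbf a,\sigma(1)}|>\dots>|\phi'_{\mathbf a,\sigma(d)}|$ for all $\mathbf a\in\mathcal D$. For $1\le j\le d$ let $\Phi_{\{1,\dots,j\}}$ be the set of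 the distinct tuples $(f_1,\dots,f_j)=(\phi_{\mathbf a,\sigma(1)},\dots,\phi_{\mathbf a,\sigma(j)})$, $\mathbf a\in\mathcal D$, each regarded as a diagonal map of $\mathbb R^j$. (Neat projection condition) for each $j\in\{1,\dots,d\}$ the images of $(0,1)^j$ under the distinct maps in $\Phi_{\{1,\dots,j\}}$ are pairwise disjoint. Define $\beta_1,\dots,\beta_d$ inductively: given $\beta_1,\dots,\beta_{j-1}$, let $\beta_j$ be the unique real number (automatically $\ge 0$) with $$\sum_{(f_1,\dots,f_j)\in\Phi_{\{1,\dots,j\}}}\ \prod_{k=1}^j |f_k'|^{\beta_k}=1 .$$ For a compact metric space $X$ and $A\subset X$ let $N_\delta(A)$ be the maximal number of pairwise disjoint open balls of $X$ of radius $\delta$ with centres in $A$. The box dimension $\dim_B X$ is the common value, when they agree, of the upper and lower limits of $\log N_\delta(X)/(-\log\delta)$ as $\delta\to0$. For $\varepsilon>0$, an $\varepsilon$-component of $X$ is an equivalence class of the relation "joined by a finite chain of points of $X$ with consecutive distances $\le\varepsilon$". A Borel measure $\mu$ on $X$ is a Minkowski measure of $X$ if $\beta=\dim_B X$ exists and there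 is a constant $M>0$ such that for every $\varepsilon>0$ and every $\varepsilon$-component $R$ of $X$, $M^{-1}\mu(R)\le N_\delta(R)\,\delta^{\beta}\le M\mu(R)$ for all sufficiently small $\delta>0$ (how small may depend on $R$). Then, with the Euclidean metric on $\Lambda_\Phi$, the box dimension of $\Lambda_\Phi$ exists and $$\dim_B\Lambda_\Phi=\sum_{j=1}^d\beta_j .$$ If moreover $\Lambda_\Phi$ is totally disconnected, then the Bernoulli measure on $\Lambda_\Phi$ with the probability weights $p_{\mathbf a}=\prod_{j=1}^d|\phi'_{\mathbf a,\sigma(j)}|^{\beta_j}$, $\mathbf a\in\mathcal D$ (the image of the product measure $p^{\mathbb N}$ on $\mathcal D^{\mathbb N}$ under $\omega\mapsto\lim_{n\to\infty}\phi_{\omega_1}\circ\dots\circ\phi_{\omega_n}(0)$), is a Minkowski measure of $\Lambda_\Phi$. -/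

import Mathlib

open Set Filter Topology MeasureTheory
open scoped ENNReal NNReal

/-! ### Packings, box dimension, Minkowski measures of metric spaces -/

section MetricNotions

variable {X : Type*} [MetricSpace X]

/-- The cardinalities of the `δ`-packings of `A`: finite families of pairwise disjoint open balls of
radius `δ` (balls of the space `X`) with centres in `A`. -/
def packingCards (δ : ℝ) (A : Set X) : Set ℕ :=
  {n | ∃ P : Finset X, (P : Set X) ⊆ A ∧
    (P : Set X).PairwiseDisjoint (fun x => Metric.ball x δ) ∧ P.card = n}

/-- `N_δ(A)`, the maximal cardinality of a `δ`-packing of `A`. In a compact space and for `δ > 0` this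
is a genuine maximum, see `bddAbove_packingCards`. -/
noncomputable def ballPackingNumber (δ : ℝ) (A : Set X) : ℕ := sSup (packingCards δ A)

theorem bddAbove_packingCards [CompactSpace X] {δ : ℝ} (hδ : 0 < δ) (A : Set X) :
    BddAbove (packingCards δ A) := by
  obtain ⟨t, -, htf, ht⟩ := Metric.totallyBounded_iff.1
    (isCompact_univ (X := X)).totallyBounded (δ / 2) (by positivity) |>.imp
      fun t h => And.intro (subset_univ t) h
  refine ⟨htf.toFinset.card, ?_⟩
  rintro n ⟨P, -, hP, rfl⟩
  have hex : ∀ x : X, ∃ y ∈ t, dist x y < δ / 2 := fun x => by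
    have := ht (mem_univ x)
    simpa using this
  choose g hgt hg using hex
  refine Finset.card_le_card_of_injOn g (fun x _ => by simpa using hgt x) ?_
  intro x hx y hy hxy
  by_contra hne
  refine Set.disjoint_left.1 (hP hx hy hne) (Metric.mem_ball_self hδ) ?_
  have h1 := hg x
  have h2 := hg y
  rw [← hxy] at h2
  have := dist_triangle_right x y (g x)
  rw [Metric.mem_ball]
  linarith

variable (X) in
/-- Upper box dimension. -/
noncomputable def upperBoxDim : EReal :=
  limsup (fun δ : ℝ =>
    ((Real.log (ballPackingNumber δ (univ : Set X)) / -Real.log δ : ℝ) : EReal)) (𝓝[>] 0)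

variable (X) in
/-- Lower box dimension. -/
noncomputable def lowerBoxDim : EReal :=
  liminf (fun δ : ℝ =>
    ((Real.log (ballPackingNumber δ (univ : Set X)) / -Real.log δ : ℝ) : EReal)) (𝓝[>] 0)

variable (X) in
/-- The box dimension of `X` exists and is equal to `s`. -/
def HasBoxDim (s : ℝ) : Prop :=
  lowerBoxDim X = (s : EReal) ∧ upperBoxDim X = (s : EReal)

/-- `x` and `y` are joined by a finite chain of points of `X` with steps of length at most `ε`. -/
def EpsEquiv (ε : ℝ) : X → X → Prop :=
  Relation.ReflTransGen (fun x y => dist x y ≤ ε)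

variable (X) in
/-- The collection of the `ε`-components of `X`. -/
def epsComponents (ε : ℝ) : Set (Set X) :=
  {R | ∃ x, R = {y | EpsEquiv ε x y}}

/-- `μ` is a Minkowski measure of `X`: the box dimension `β` of `X` exists and, for one constant `M`
and every `ε`-component `R` of `X`, `M⁻¹ μ(R) ≤ N_δ(R) δ^β ≤ M μ(R)` for all small `δ > 0`. -/
def IsMinkowskiMeasure [MeasurableSpace X] [BorelSpace X] (μ : Measure X) : Prop :=
  ∃ β : ℝ, HasBoxDim X β ∧ ∃ M : ℝ, 0 < M ∧ ∀ ε : ℝ, 0 < ε → ∀ R ∈ epsComponents X ε,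
    ∀ᶠ δ : ℝ in 𝓝[>] 0,
      ENNReal.ofReal M⁻¹ * μ R ≤ ENNReal.ofReal (ballPackingNumber δ R * δ ^ β) ∧
      ENNReal.ofReal (ballPackingNumber δ R * δ ^ β) ≤ ENNReal.ofReal M * μ R

end MetricNotions

/-! ### Diagonal iterated function systems -/

/-- A contracting similarity of `[0,1]`, i.e. a map `x ↦ slope * x + shift` with `0 < |slope| < 1`
that sends `[0,1]` into itself. -/
@[ext]
structure ContractingSimilarity where
  slope : ℝ
  shift : ℝ
  slope_ne_zero : slope ≠ 0
  abs_slope_lt_one : |slope| < 1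
  mapsTo : MapsTo (fun x => slope * x + shift) (Icc 0 1) (Icc 0 1)

/-- The map itself, on the real line. -/
def ContractingSimilarity.toFun (f : ContractingSimilarity) (x : ℝ) : ℝ := f.slope * x + f.shift

/-- A diagonal iterated function system on `ℝ^d`: a finite base system of contracting similarities of
`[0,1]` in each coordinate (its maps serve as their own indices), and a nonempty set of digits
contained in the product of the base systems. -/
structure DiagonalIFS (d : ℕ) where
  base : Fin d → Finset ContractingSimilarity
  digits : Finset (Fin d → ContractingSimilarity)
  digits_nonempty : digits.Nonempty
  mem_base : ∀ a ∈ digits, ∀ i, a i ∈ base i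

/-- The diagonal affine map `x ↦ (a_1(x_1), …, a_d(x_d))` of `ℝ^d`. -/
noncomputable def diagMap {d : ℕ} (a : Fin d → ContractingSimilarity)
    (x : EuclideanSpace ℝ (Fin d)) : EuclideanSpace ℝ (Fin d) :=
  WithLp.toLp 2 (fun i => (a i).toFun (x i))

theorem lipschitzWith_diagMap {d : ℕ} (a : Fin d → ContractingSimilarity) (c : ℝ≥0)
    (hc : ∀ i, |(a i).slope| ≤ c) : LipschitzWith c (diagMap a) := by
  refine LipschitzWith.of_dist_le_mul fun x y => ?_
  rw [EuclideanSpace.dist_eq, EuclideanSpace.dist_eq, ← Real.sqrt_sq c.coe_nonneg,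
    ← Real.sqrt_mul (sq_nonneg _), Finset.mul_sum]
  refine Real.sqrt_le_sqrt (Finset.sum_le_sum fun i _ => ?_)
  have h : dist ((diagMap a x) i) ((diagMap a y) i) = |(a i).slope| * dist (x i) (y i) := by
    rw [Real.dist_eq, Real.dist_eq, ← abs_mul]
    simp only [diagMap, ContractingSimilarity.toFun]
    congr 1
    ring
  rw [h, mul_pow]
  gcongr
  exact hc i

namespace DiagonalIFS

variable {d : ℕ} (Φ : DiagonalIFS d)

theorem exists_ratio : ∃ c : ℝ≥0, c < 1 ∧ ∀ a ∈ Φ.digits, LipschitzWith c (diagMap a) := by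
  classical
  let S : Finset ℝ≥0 := insert 0 (Φ.digits.biUnion fun a => Finset.univ.image fun i =>
    Real.nnabs (a i).slope)
  have hS : S.Nonempty := ⟨0, by simp [S]⟩
  refine ⟨S.max' hS, ?_, fun a ha => lipschitzWith_diagMap a _ fun i => ?_⟩
  · rw [Finset.max'_lt_iff]
    intro y hy
    simp only [S, Finset.mem_insert, Finset.mem_biUnion, Finset.mem_image, Finset.mem_univ,
      true_and] at hy
    rcases hy with rfl | ⟨a, -, i, rfl⟩
    · exact zero_lt_one
    · rw [← NNReal.coe_lt_coe]
      simpa using (a i).abs_slope_lt_one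
  · have : Real.nnabs (a i).slope ≤ S.max' hS := by
      refine Finset.le_max' _ _ ?_
      simp only [S, Finset.mem_insert, Finset.mem_biUnion, Finset.mem_image, Finset.mem_univ,
        true_and]
      exact Or.inr ⟨a, ha, i, rfl⟩
    rw [← NNReal.coe_le_coe] at this
    simpa using this

/-- `E` is an invariant set of the system: `E` is nonempty, compact, and `E = ⋃_a φ_a(E)`. -/
def IsInvariant (E : Set (EuclideanSpace ℝ (Fin d))) : Prop :=
  E.Nonempty ∧ IsCompact E ∧ E = ⋃ a ∈ Φ.digits, diagMap a '' E

theorem existsUnique_isInvariant : ∃! E, Φ.IsInvariant E := by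
  obtain ⟨c, hc1, hc⟩ := Φ.exists_ratio
  let H : TopologicalSpace.NonemptyCompacts (EuclideanSpace ℝ (Fin d)) →
      TopologicalSpace.NonemptyCompacts (EuclideanSpace ℝ (Fin d)) := fun K =>
    ⟨⟨⋃ a ∈ Φ.digits, diagMap a '' K,
      Φ.digits.isCompact_biUnion fun a ha => K.isCompact.image (hc a ha).continuous⟩, by
        obtain ⟨a, ha⟩ := Φ.digits_nonempty
        obtain ⟨x, hx⟩ := K.nonempty
        exact ⟨diagMap a x, mem_biUnion ha (mem_image_of_mem _ hx)⟩⟩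
  have key : ∀ K L : TopologicalSpace.NonemptyCompacts (EuclideanSpace ℝ (Fin d)),
      ∀ x ∈ (H K : Set (EuclideanSpace ℝ (Fin d))),
        Metric.infEDist x (H L : Set (EuclideanSpace ℝ (Fin d))) ≤ c * edist K L := by
    intro K L x hx
    obtain ⟨a, ha, y, hy, rfl⟩ := mem_iUnion₂.1 hx
    obtain ⟨z, hz, hyz⟩ := L.isCompact.exists_infEDist_eq_edist L.nonempty y
    calc Metric.infEDist (diagMap a y) (H L : Set (EuclideanSpace ℝ (Fin d)))
        ≤ edist (diagMap a y) (diagMap a z) :=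
          Metric.infEDist_le_edist_of_mem (mem_biUnion ha (mem_image_of_mem _ hz))
      _ ≤ c * edist y z := hc a ha y z
      _ ≤ c * edist K L := by
          rw [← hyz]
          gcongr
          exact Metric.infEDist_le_hausdorffEDist_of_mem hy
  have hH : ContractingWith c H := ⟨hc1, fun K L =>
    Metric.hausdorffEDist_le_of_infEDist (key K L) fun x hx => by
      rw [edist_comm]; exact key L K x hx⟩
  have : Nonempty (TopologicalSpace.NonemptyCompacts (EuclideanSpace ℝ (Fin d))) :=
    ⟨⟨⟨{0}, isCompact_singleton⟩, singleton_nonempty _⟩⟩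
  refine ⟨(ContractingWith.fixedPoint H hH : TopologicalSpace.NonemptyCompacts _),
    ⟨TopologicalSpace.NonemptyCompacts.nonempty _, TopologicalSpace.NonemptyCompacts.isCompact _,
      ?_⟩, ?_⟩
  · exact congrArg (fun K : TopologicalSpace.NonemptyCompacts (EuclideanSpace ℝ (Fin d)) =>
      (K : Set (EuclideanSpace ℝ (Fin d)))) hH.fixedPoint_isFixedPt.symm
  · rintro E ⟨hne, hE, hEq⟩
    have hfix : Function.IsFixedPt H ⟨⟨E, hE⟩, hne⟩ := by
      apply TopologicalSpace.NonemptyCompacts.ext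
      exact hEq.symm
    exact congrArg (fun K : TopologicalSpace.NonemptyCompacts (EuclideanSpace ℝ (Fin d)) =>
      (K : Set (EuclideanSpace ℝ (Fin d)))) (hH.fixedPoint_unique hfix)

/-- The diagonal self-affine sponge `Λ_Φ`: the unique invariant set of `Φ`. -/
noncomputable def sponge : Set (EuclideanSpace ℝ (Fin d)) := Φ.existsUnique_isInvariant.choose

theorem sponge_isInvariant : Φ.IsInvariant Φ.sponge := Φ.existsUnique_isInvariant.choose_spec.1

/-- Coordinate ordering condition, realised by the permutation `σ`:
`|φ'_{a,σ(1)}| > ⋯ > |φ'_{a,σ(d)}|` for all digits `a`. -/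
def CoordinateOrdering (σ : Equiv.Perm (Fin d)) : Prop :=
  ∀ a ∈ Φ.digits, ∀ i j : Fin d, i < j → |(a (σ j)).slope| < |(a (σ i)).slope|

open Classical in
/-- The projected system on the coordinates `σ(1), …, σ(j)`. Being a set of tuples of maps, it contains
each map once. (As `Fin d` starts at `0`, the number of coordinates is `j + 1` for `j : Fin d`.) -/
noncomputable def proj (σ : Equiv.Perm (Fin d)) (j : Fin d) :
    Finset (Iic j → ContractingSimilarity) :=
  Φ.digits.image fun a k => a (σ k)

/-- Neat projection condition: for every `j`, the images of the open unit cube under the different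
maps of the projected system are pairwise disjoint. -/
def NeatProjection (σ : Equiv.Perm (Fin d)) : Prop :=
  ∀ j : Fin d, ∀ f ∈ Φ.proj σ j, ∀ g ∈ Φ.proj σ j, f ≠ g →
    Disjoint
      ((fun (x : Iic j → ℝ) k => (f k).toFun (x k)) '' univ.pi fun _ => Ioo 0 1)
      ((fun (x : Iic j → ℝ) k => (g k).toFun (x k)) '' univ.pi fun _ => Ioo 0 1)

/-- The equations defining `β_1, …, β_d` inductively:
`∑_{(f_1, …, f_j) ∈ Φ_{1, …, j}} ∏_{k ≤ j} |f_k'| ^ β_k = 1` for each `j`. -/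
def IsExponents (σ : Equiv.Perm (Fin d)) (β : Fin d → ℝ) : Prop :=
  ∀ j : Fin d, ∑ f ∈ Φ.proj σ j, ∏ k : Iic j, |(f k).slope| ^ β k = 1

end DiagonalIFS

theorem existsUnique_sum_mul_rpow_eq_one {ι : Type*} (s : Finset ι) (hs : s.Nonempty)
    (w r : ι → ℝ) (hw : ∀ i ∈ s, 0 < w i) (hr0 : ∀ i ∈ s, 0 < r i) (hr1 : ∀ i ∈ s, r i < 1) :
    ∃! t : ℝ, ∑ i ∈ s, w i * r i ^ t = 1 := by
  have hcont : Continuous fun t : ℝ => ∑ i ∈ s, w i * r i ^ t :=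
    continuous_finsetSum _ fun i hi =>
      continuous_const.mul (Real.continuous_const_rpow (hr0 i hi).ne')
  have hanti : StrictAnti fun t : ℝ => ∑ i ∈ s, w i * r i ^ t := by
    intro t u htu
    refine Finset.sum_lt_sum_of_nonempty hs fun i hi => ?_
    exact mul_lt_mul_of_pos_left
      (Real.rpow_lt_rpow_of_exponent_gt (hr0 i hi) (hr1 i hi) htu) (hw i hi)
  have htop : Tendsto (fun t : ℝ => ∑ i ∈ s, w i * r i ^ t) atTop (𝓝 0) := by
    have : Tendsto (fun t : ℝ => ∑ i ∈ s, w i * r i ^ t) atTop (𝓝 (∑ i ∈ s, w i * 0)) :=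
      tendsto_finsetSum _ fun i hi => (tendsto_rpow_atTop_of_base_lt_one (r i)
        (by linarith [hr0 i hi]) (hr1 i hi)).const_mul _
    simpa using this
  have hbot : Tendsto (fun t : ℝ => ∑ i ∈ s, w i * r i ^ t) atBot atTop := by
    obtain ⟨i, hi⟩ := hs
    refine tendsto_atTop_mono (f := fun t : ℝ => w i * r i ^ t) (fun t => ?_) ?_
    · exact Finset.single_le_sum (f := fun i => w i * r i ^ t)
        (fun k hk => (mul_pos (hw k hk) (Real.rpow_pos_of_pos (hr0 k hk) t)).le) hi
    · exact (tendsto_rpow_atBot_of_base_lt_one (r i) (hr0 i hi) (hr1 i hi)).const_mul_atTop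
        (hw i hi)
  obtain ⟨a, ha⟩ := (hbot.eventually_ge_atTop 1).exists
  obtain ⟨b, hb⟩ := (htop.eventually_le_const zero_lt_one).exists
  obtain ⟨t, ht⟩ := mem_range_of_exists_le_of_exists_ge hcont ⟨b, hb⟩ ⟨a, ha⟩
  exact ⟨t, ht, fun u hu => hanti.injective (hu.trans ht.symm)⟩

namespace DiagonalIFS

variable {d : ℕ} (Φ : DiagonalIFS d)

theorem sum_proj_eq (σ : Equiv.Perm (Fin d)) (j : Fin d) (β : Fin d → ℝ) :
    ∑ f ∈ Φ.proj σ j, ∏ k : Iic j, |(f k).slope| ^ β k =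
      ∑ f ∈ Φ.proj σ j, (∏ k ∈ ({⟨j, le_refl j⟩}ᶜ : Finset (Iic j)), |(f k).slope| ^ β k) *
        |(f ⟨j, le_refl j⟩).slope| ^ β j :=
  Finset.sum_congr rfl fun f _ => by
    rw [Fintype.prod_eq_mul_prod_compl (⟨j, le_refl j⟩ : Iic j), mul_comm]

theorem lt_of_mem_compl {j : Fin d} {k : Iic j}
    (hk : k ∈ ({⟨j, le_refl j⟩}ᶜ : Finset (Iic j))) : (k : Fin d) < j := by
  refine lt_of_le_of_ne k.2 fun h => ?_
  rw [Finset.mem_compl, Finset.mem_singleton] at hk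
  exact hk (Subtype.ext h)

open Classical in
theorem proj_nonempty (σ : Equiv.Perm (Fin d)) (j : Fin d) : (Φ.proj σ j).Nonempty :=
  Φ.digits_nonempty.image _

theorem existsUnique_step (σ : Equiv.Perm (Fin d)) (j : Fin d) (β : Fin d → ℝ) :
    ∃! t : ℝ, ∑ f ∈ Φ.proj σ j,
      (∏ k ∈ ({⟨j, le_refl j⟩}ᶜ : Finset (Iic j)), |(f k).slope| ^ β k) *
        |(f ⟨j, le_refl j⟩).slope| ^ t = 1 :=
  existsUnique_sum_mul_rpow_eq_one _ (Φ.proj_nonempty σ j) _ _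
    (fun f _ => Finset.prod_pos fun k _ =>
      Real.rpow_pos_of_pos (abs_pos.2 (f k).slope_ne_zero) _)
    (fun f _ => abs_pos.2 (f _).slope_ne_zero) (fun f _ => (f _).abs_slope_lt_one)

theorem existsUnique_isExponents (σ : Equiv.Perm (Fin d)) : ∃! β, Φ.IsExponents σ β := by
  have hex : ∀ n ≤ d, ∃ β : Fin d → ℝ, ∀ j : Fin d, (j : ℕ) < n →
      ∑ f ∈ Φ.proj σ j, ∏ k : Iic j, |(f k).slope| ^ β k = 1 := by
    intro n
    induction n with
    | zero => exact fun _ => ⟨0, fun j hj => absurd hj (Nat.not_lt_zero _)⟩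
    | succ n ih =>
      intro hn
      obtain ⟨β, hβ⟩ := ih (Nat.le_of_succ_le hn)
      let m : Fin d := ⟨n, hn⟩
      obtain ⟨t, ht, -⟩ := Φ.existsUnique_step σ m β
      refine ⟨Function.update β m t, fun j hj => ?_⟩
      rcases Nat.lt_succ_iff_lt_or_eq.1 hj with h | h
      · rw [← hβ j h]
        refine Finset.sum_congr rfl fun f _ => Finset.prod_congr rfl fun k _ => ?_
        have hk : (k : Fin d) ≠ m := by
          have h1 : (k : Fin d) ≤ j := k.2
          intro h2
          rw [h2, Fin.le_def] at h1
          exact absurd h1 (not_le.2 h)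
        rw [Function.update_of_ne hk]
      · obtain rfl : j = m := Fin.ext h
        rw [sum_proj_eq, Function.update_self]
        rw [← ht]
        refine Finset.sum_congr rfl fun f _ => ?_
        congr 1
        refine Finset.prod_congr rfl fun k hk => ?_
        rw [Function.update_of_ne (lt_of_mem_compl hk).ne]
  obtain ⟨β, hβ⟩ := hex d le_rfl
  refine ⟨β, fun j => hβ j j.2, fun γ hγ => ?_⟩
  have main : ∀ n : ℕ, ∀ j : Fin d, (j : ℕ) = n → γ j = β j := by
    intro n
    induction n using Nat.strong_induction_on with
    | _ n ih =>
      intro j hj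
      refine (Φ.existsUnique_step σ j β).unique ?_ ?_
      · have h := hγ j
        rw [sum_proj_eq] at h
        rw [← h]
        refine Finset.sum_congr rfl fun f _ => ?_
        congr 1
        refine Finset.prod_congr rfl fun k hk => ?_
        rw [ih k (hj ▸ lt_of_mem_compl hk) k rfl]
      · have h := hβ j j.2
        rwa [sum_proj_eq] at h
  exact funext fun j => main j j rfl

/-- The numbers `β_1, …, β_d` (the `j`-th one belongs to the coordinate `σ(j)`). -/
noncomputable def exponents (σ : Equiv.Perm (Fin d)) : Fin d → ℝ :=
  (Φ.existsUnique_isExponents σ).choose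

theorem exponents_spec (σ : Equiv.Perm (Fin d)) : Φ.IsExponents σ (Φ.exponents σ) :=
  (Φ.existsUnique_isExponents σ).choose_spec.1

/-- The finite alphabet of digits, with the discrete σ-algebra. -/
def Letter : Type := {a // a ∈ Φ.digits}

noncomputable instance : Fintype Φ.Letter := inferInstanceAs (Fintype {a // a ∈ Φ.digits})

instance : MeasurableSpace Φ.Letter := ⊤

/-- The weight `p_a = ∏_j |f_j'| ^ β_j` of a digit. -/
noncomputable def weight (σ : Equiv.Perm (Fin d)) (a : Φ.Letter) : ℝ :=
  ∏ j : Fin d, |(a.1 (σ j)).slope| ^ Φ.exponents σ j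

theorem weight_nonneg (σ : Equiv.Perm (Fin d)) (a : Φ.Letter) : 0 ≤ Φ.weight σ a :=
  Finset.prod_nonneg fun _ _ => Real.rpow_nonneg (abs_nonneg _) _

theorem sum_weight (σ : Equiv.Perm (Fin d)) : ∑ a : Φ.Letter, Φ.weight σ a = 1 := by
  classical
  have h0 : ∑ a : Φ.Letter, Φ.weight σ a =
      ∑ a ∈ Φ.digits, ∏ j : Fin d, |(a (σ j)).slope| ^ Φ.exponents σ j :=
    Finset.sum_coe_sort Φ.digits fun a => ∏ j : Fin d, |(a (σ j)).slope| ^ Φ.exponents σ j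
  rw [h0]
  rcases Nat.eq_zero_or_pos d with rfl | hd
  · obtain ⟨a, ha⟩ := Φ.digits_nonempty
    have : Φ.digits = {a} := Finset.eq_singleton_iff_unique_mem.2
      ⟨ha, fun b _ => Subsingleton.elim _ _⟩
    simp [this]
  · let m : Fin d := ⟨d - 1, by omega⟩
    have hm : ∀ k : Fin d, k ∈ Iic m := fun k => by
      rw [mem_Iic, Fin.le_def]
      have := k.2
      simp only [m]
      omega
    have h := Φ.exponents_spec σ m
    rw [proj, Finset.sum_image] at h
    · rw [← h]
      refine Finset.sum_congr rfl fun a _ => ?_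
      exact (Equiv.prod_comp (Equiv.subtypeUnivEquiv hm)
        fun j => |(a (σ j)).slope| ^ Φ.exponents σ j).symm
    · intro a _ b _ hab
      funext i
      have := congrFun hab ⟨σ.symm i, hm _⟩
      simpa using this

/-- The probability vector `(p_a)` on the digits. -/
noncomputable def letterLaw (σ : Equiv.Perm (Fin d)) : PMF Φ.Letter :=
  PMF.ofFintype (fun a => ENNReal.ofReal (Φ.weight σ a)) (by
    rw [← ENNReal.ofReal_sum_of_nonneg fun a _ => Φ.weight_nonneg σ a, Φ.sum_weight,
      ENNReal.ofReal_one])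

/-- `φ_{ω_0} ∘ ⋯ ∘ φ_{ω_{n-1}}`. -/
noncomputable def wordMap (ω : ℕ → Φ.Letter) :
    ℕ → EuclideanSpace ℝ (Fin d) → EuclideanSpace ℝ (Fin d)
  | 0, x => x
  | n + 1, x => wordMap ω n (diagMap (ω n).1 x)

/-- The sequence `φ_{ω_0} ∘ ⋯ ∘ φ_{ω_{n-1}}(x)` converges to a point of the sponge which does not
depend on `x`. -/
theorem exists_tendsto_wordMap (ω : ℕ → Φ.Letter) :
    ∃ y : Φ.sponge, ∀ x, Tendsto (fun n => Φ.wordMap ω n x) atTop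
      (𝓝 (y : EuclideanSpace ℝ (Fin d))) := by
  obtain ⟨c, hc1, hc⟩ := Φ.exists_ratio
  obtain ⟨⟨x₀, hx₀⟩, hcpt, hinv⟩ := Φ.sponge_isInvariant
  have hlip : ∀ n x y, dist (Φ.wordMap ω n x) (Φ.wordMap ω n y) ≤ (c : ℝ) ^ n * dist x y := by
    intro n
    induction n with
    | zero => intro x y; simp [wordMap]
    | succ n ih =>
      intro x y
      calc _ ≤ (c : ℝ) ^ n * dist (diagMap (ω n).1 x) (diagMap (ω n).1 y) := ih _ _
        _ ≤ (c : ℝ) ^ n * (c * dist x y) := by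
          gcongr
          exact (hc _ (ω n).2).dist_le_mul x y
        _ = _ := by ring
  have hmaps : ∀ a ∈ Φ.digits, ∀ x ∈ Φ.sponge, diagMap a x ∈ Φ.sponge := fun a ha x hx => by
    rw [hinv]
    exact mem_biUnion ha (mem_image_of_mem _ hx)
  have hmem : ∀ n, ∀ x ∈ Φ.sponge, Φ.wordMap ω n x ∈ Φ.sponge := by
    intro n
    induction n with
    | zero => exact fun x hx => hx
    | succ n ih => exact fun x hx => ih _ (hmaps _ (ω n).2 x hx)
  obtain ⟨C, hC⟩ := hcpt.isBounded.exists_norm_le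
  have hcauchy : CauchySeq fun n => Φ.wordMap ω n x₀ := by
    refine cauchySeq_of_le_geometric (c : ℝ) (C + C) (by exact_mod_cast hc1) fun n => ?_
    refine (hlip n x₀ (diagMap (ω n).1 x₀)).trans ?_
    rw [mul_comm]
    gcongr
    refine (dist_le_norm_add_norm _ _).trans ?_
    exact add_le_add (hC _ hx₀) (hC _ (hmaps _ (ω n).2 _ hx₀))
  obtain ⟨y, hy⟩ := cauchySeq_tendsto_of_complete hcauchy
  refine ⟨⟨y, hcpt.isClosed.mem_of_tendsto hy (Eventually.of_forall fun n => hmem n _ hx₀)⟩,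
    fun x => ?_⟩
  refine tendsto_of_tendsto_of_dist hy ?_
  refine squeeze_zero (fun _ => dist_nonneg) (fun n => hlip n x₀ x) ?_
  have := (tendsto_pow_atTop_nhds_zero_of_lt_one c.coe_nonneg
    (by exact_mod_cast hc1)).mul_const (dist x₀ x)
  simpa using this

/-- The coding map `ω ↦ lim φ_{ω_0} ∘ ⋯ ∘ φ_{ω_{n-1}}(x)` from sequences of digits to the sponge. -/
noncomputable def coding (ω : ℕ → Φ.Letter) : Φ.sponge := (Φ.exists_tendsto_wordMap ω).choose

theorem tendsto_coding (ω : ℕ → Φ.Letter) (x : EuclideanSpace ℝ (Fin d)) :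
    Tendsto (fun n => Φ.wordMap ω n x) atTop (𝓝 (Φ.coding ω : EuclideanSpace ℝ (Fin d))) :=
  (Φ.exists_tendsto_wordMap ω).choose_spec x

theorem measurable_coding : Measurable Φ.coding := by
  have hd : ∀ a : Fin d → ContractingSimilarity, Continuous (diagMap a) := fun a =>
    (lipschitzWith_diagMap a 1 fun i => by simpa using (a i).abs_slope_lt_one.le).continuous
  have hw : ∀ n, Measurable fun p : (ℕ → Φ.Letter) × EuclideanSpace ℝ (Fin d) =>
      Φ.wordMap p.1 n p.2 := by
    intro n
    induction n with
    | zero => exact measurable_snd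
    | succ n ih =>
      have h1 : Measurable fun q : Φ.Letter × EuclideanSpace ℝ (Fin d) => diagMap q.1.1 q.2 :=
        measurable_from_prod_countable_right fun a => (hd a.1).measurable
      have h2 : Measurable fun p : (ℕ → Φ.Letter) × EuclideanSpace ℝ (Fin d) => (p.1 n, p.2) :=
        ((measurable_pi_apply n).comp measurable_fst).prodMk measurable_snd
      exact ih.comp (measurable_fst.prodMk (h1.comp h2))
  have hlim : Measurable fun ω => (Φ.coding ω : EuclideanSpace ℝ (Fin d)) :=
    measurable_of_tendsto_metrizable (f := fun n ω => Φ.wordMap ω n 0)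
      (fun n => (hw n).comp (measurable_id.prodMk measurable_const))
      (tendsto_pi_nhds.2 fun ω => Φ.tendsto_coding ω 0)
  exact hlim.subtype_mk

/-- The Bernoulli measure on the sponge with the weights `p_a`: the image under the coding map of the
product measure on the sequences of digits. -/
noncomputable def bernoulliMeasure (σ : Equiv.Perm (Fin d)) : Measure Φ.sponge :=
  (Measure.infinitePi fun _ : ℕ => (Φ.letterLaw σ).toMeasure).map Φ.coding

end DiagonalIFS

/-! ### Contracting similarities and the unit cube -/

namespace ContractingSimilarity

/-! The sponge is covered by boxes that are nearly cubes, and these are counted through an identity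
that survives subdivision. Give each coordinate, in order of rank, a target side `s k`, increasing
with `k`. If the target of the last coordinate in play is at least `1`, that coordinate needs no
cutting: its side is the whole unit interval and it is dropped. Otherwise all targets in play are
below `1`; cut with the projected system on those coordinates and continue inside the image of `f`
with targets `s k / |f_k'|`. The coordinate ordering keeps the targets increasing, neat projections
keep the open boxes disjoint, and the equation for `β_j` says exactly that cutting preserves
`∑_boxes ∏_k |side_k| ^ β_k = 1` (`nonempty_boxFamily_sponge`).

With all targets equal to `δ` every side lies between `c δ` and `δ`, so each summand is comparable
to `δ ^ ∑ β` and the number of boxes to `δ ^ (-∑ β)` (`BoxFamily.card_bounds`). A diameter bound and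
a volume bound compare this number with the packing number, which gives the dimension.

For a piece `R` surrounded by a gap, cut first with the full system until every cylinder is
contained in `R` or misses it. Self-similarity of the Bernoulli measure (`mass_eq_sum`) follows the
same recursion, so the sum over the boxes of `R` equals the measure of `R`
(`nonempty_boxFamily_inter`). The comparison constants do not depend on `R`; only the threshold for
`δ` does. -/

theorem toFun_mem_Icc (f : ContractingSimilarity) {t : ℝ} (ht : t ∈ Icc (0 : ℝ) 1) :
    f.toFun t ∈ Icc (0 : ℝ) 1 := f.mapsTo ht

theorem toFun_mem_Ioo (f : ContractingSimilarity) {t : ℝ} (ht : t ∈ Ioo (0 : ℝ) 1) :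
    f.toFun t ∈ Ioo (0 : ℝ) 1 := by
  have h0 := f.toFun_mem_Icc (left_mem_Icc.2 zero_le_one)
  have h1 := f.toFun_mem_Icc (right_mem_Icc.2 zero_le_one)
  simp only [toFun, mul_zero, zero_add, mul_one, mem_Icc, mem_Ioo] at *
  obtain ⟨ht0, ht1⟩ := ht
  rcases lt_or_gt_of_ne f.slope_ne_zero with h | h
  · have := mul_pos (neg_pos.2 h) ht0
    have := mul_pos (neg_pos.2 h) (sub_pos.2 ht1)
    constructor <;> nlinarith
  · have := mul_pos h ht0
    have := mul_pos h (sub_pos.2 ht1)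
    constructor <;> nlinarith

/-- `max (-t) (t - 1)` measures how far `t` lies outside of `[0,1]`. -/
theorem excess_toFun_le (f : ContractingSimilarity) (t : ℝ) :
    max (-f.toFun t) (f.toFun t - 1) ≤ |f.slope| * max (-t) (t - 1) := by
  have h0 := f.toFun_mem_Icc (left_mem_Icc.2 zero_le_one)
  have h1 := f.toFun_mem_Icc (right_mem_Icc.2 zero_le_one)
  simp only [toFun, mul_zero, zero_add, mul_one, mem_Icc] at *
  have hl := le_max_left (-t) (t - 1)
  have hr := le_max_right (-t) (t - 1)
  rcases lt_or_gt_of_ne f.slope_ne_zero with h | h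
  · rw [abs_of_neg h]
    have := mul_le_mul_of_nonneg_left hl (neg_pos.2 h).le
    have := mul_le_mul_of_nonneg_left hr (neg_pos.2 h).le
    exact max_le (by linarith) (by linarith)
  · rw [abs_of_pos h]
    have := mul_le_mul_of_nonneg_left hl h.le
    have := mul_le_mul_of_nonneg_left hr h.le
    exact max_le (by linarith) (by linarith)

end ContractingSimilarity

namespace DiagonalIFS

variable {d : ℕ} (Φ : DiagonalIFS d)

theorem sponge_eq : Φ.sponge = ⋃ a ∈ Φ.digits, diagMap a '' Φ.sponge := Φ.sponge_isInvariant.2.2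

theorem isCompact_sponge : IsCompact Φ.sponge := Φ.sponge_isInvariant.2.1

theorem diagMap_mem_sponge {a : Fin d → ContractingSimilarity} (ha : a ∈ Φ.digits)
    {x : EuclideanSpace ℝ (Fin d)} (hx : x ∈ Φ.sponge) : diagMap a x ∈ Φ.sponge := by
  rw [sponge_eq]
  exact mem_biUnion ha (mem_image_of_mem _ hx)

theorem exists_digit_of_mem_sponge {x : EuclideanSpace ℝ (Fin d)} (hx : x ∈ Φ.sponge) :
    ∃ a ∈ Φ.digits, ∃ y ∈ Φ.sponge, diagMap a y = x := by
  rw [sponge_eq] at hx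
  simpa using hx

/-- Maximum principle: the largest excess over the sponge is attained at some `φ_a(y)`, hence is at
most `|slope| < 1` times the excess of `y`, which is no larger than the maximum. So the maximum is
not positive. -/
theorem sponge_coord_mem {x : EuclideanSpace ℝ (Fin d)} (hx : x ∈ Φ.sponge) (i : Fin d) :
    x i ∈ Icc (0 : ℝ) 1 := by
  obtain ⟨z, hz, hmax⟩ := Φ.isCompact_sponge.exists_isMaxOn ⟨x, hx⟩
    (f := fun x => max (-x i) (x i - 1)) (by fun_prop)
  have hxz : max (-x i) (x i - 1) ≤ max (-z i) (z i - 1) := hmax hx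
  have hle : max (-z i) (z i - 1) ≤ 0 := by
    obtain ⟨a, -, y, hy, rfl⟩ := Φ.exists_digit_of_mem_sponge hz
    have h1 : max (-y i) (y i - 1) ≤ max (-(diagMap a y) i) ((diagMap a y) i - 1) := hmax hy
    have h2 : max (-(diagMap a y) i) ((diagMap a y) i - 1) ≤ |(a i).slope| * max (-y i) (y i - 1) :=
      (a i).excess_toFun_le (y i)
    have h3 := (a i).abs_slope_lt_one
    have h4 := abs_nonneg (a i).slope
    by_contra! h
    nlinarith [mul_le_mul_of_nonneg_left h1 h4]
  have := max_le_iff.1 (hxz.trans hle)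
  exact ⟨by linarith, by linarith⟩

/-! ### Families of approximate cubes -/

/-- The ranks less than `j`. -/
def lowRanks (d j : ℕ) : Finset (Fin d) := Finset.univ.filter fun k : Fin d => (k : ℕ) < j

theorem mem_lowRanks {j : ℕ} {k : Fin d} : k ∈ lowRanks d j ↔ (k : ℕ) < j := by simp [lowRanks]

theorem lowRanks_succ (k₀ : Fin d) : lowRanks d (k₀ + 1) = insert k₀ (lowRanks d k₀) := by
  ext k
  simp only [mem_lowRanks, Finset.mem_insert, Fin.ext_iff]
  omega

theorem lowRanks_self : lowRanks d d = Finset.univ := by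
  ext k
  simp [mem_lowRanks]

/-- A finite family of boxes `∏_{k < j} (len i k) • [0,1] + off i k` in the coordinates of rank `< j`
(the rank `k` coordinate being `σ k`) with sides comparable to `s k`, which covers `R`, each box
meeting `R`, such that the open boxes are pairwise disjoint subsets of the open unit cube and such
that `∑_i ∏_{k < j} |len i k| ^ β k = m`. -/
structure BoxFamily (σ : Equiv.Perm (Fin d)) (β : Fin d → ℝ) (c : ℝ) (j : ℕ) (s : Fin d → ℝ)
    (R : Set (EuclideanSpace ℝ (Fin d))) (m : ℝ) where
  ι : Type
  fintype : Fintype ι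
  len : ι → Fin d → ℝ
  off : ι → Fin d → ℝ
  le_len : ∀ i (k : Fin d), (k : ℕ) < j → c * s k ≤ |len i k|
  len_le : ∀ i (k : Fin d), (k : ℕ) < j → |len i k| ≤ s k
  -- Staying inside the open cube is what lets disjointness of the images of the cube pass to the
  -- boxes when families are glued.
  mem_unit : ∀ i (k : Fin d), (k : ℕ) < j → ∀ t ∈ Ioo (0 : ℝ) 1, len i k * t + off i k ∈ Ioo (0 : ℝ) 1
  meets : ∀ i, ∃ x ∈ R, ∀ k : Fin d, (k : ℕ) < j →
    ∃ t ∈ Icc (0 : ℝ) 1, x (σ k) = len i k * t + off i k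
  covers : ∀ x ∈ R, ∃ i, ∀ k : Fin d, (k : ℕ) < j →
    ∃ t ∈ Icc (0 : ℝ) 1, x (σ k) = len i k * t + off i k
  disj : ∀ i i', i ≠ i' → ∀ t t' : Fin d → ℝ, (∀ k, t k ∈ Ioo (0 : ℝ) 1) →
    (∀ k, t' k ∈ Ioo (0 : ℝ) 1) →
    ∃ k : Fin d, (k : ℕ) < j ∧ len i k * t k + off i k ≠ len i' k * t' k + off i' k
  mass : ∑ i, ∏ k ∈ lowRanks d j, |len i k| ^ β k = m

namespace BoxFamily

attribute [instance] BoxFamily.fintype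

variable {σ : Equiv.Perm (Fin d)} {β : Fin d → ℝ} {c : ℝ} {j : ℕ} {s : Fin d → ℝ}

/-- The empty family. -/
def empty : BoxFamily σ β c j s ∅ 0 where
  ι := Empty
  fintype := inferInstance
  len := fun i => i.elim
  off := fun i => i.elim
  le_len := fun i => i.elim
  len_le := fun i => i.elim
  mem_unit := fun i => i.elim
  meets := fun i => i.elim
  covers := fun x hx => absurd hx (notMem_empty x)
  disj := fun i => i.elim
  mass := by simp

/-- The family consisting of the whole space, in no coordinates. -/
def point {R : Set (EuclideanSpace ℝ (Fin d))} (hR : R.Nonempty) : BoxFamily σ β c 0 s R 1 where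
  ι := Unit
  fintype := inferInstance
  len := fun _ _ => 1
  off := fun _ _ => 0
  le_len := fun _ _ h => absurd h (Nat.not_lt_zero _)
  len_le := fun _ _ h => absurd h (Nat.not_lt_zero _)
  mem_unit := fun _ _ h => absurd h (Nat.not_lt_zero _)
  meets := fun _ => ⟨hR.some, hR.some_mem, fun _ h => absurd h (Nat.not_lt_zero _)⟩
  covers := fun _ _ => ⟨(), fun _ h => absurd h (Nat.not_lt_zero _)⟩
  disj := fun _ _ h => absurd rfl h
  mass := by simp [lowRanks]

/-- Adjoining a full unit interval in the coordinate of rank `k₀`. -/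
noncomputable def adjoin (k₀ : Fin d) {R : Set (EuclideanSpace ℝ (Fin d))} {m : ℝ}
    (hR : ∀ x ∈ R, ∀ i, x i ∈ Icc (0 : ℝ) 1) (h1 : 1 ≤ s k₀) (h2 : c * s k₀ ≤ 1)
    (B : BoxFamily σ β c k₀ s R m) : BoxFamily σ β c (k₀ + 1) s R m where
  ι := B.ι
  fintype := B.fintype
  len := fun i => Function.update (B.len i) k₀ 1
  off := fun i => Function.update (B.off i) k₀ 0
  le_len := fun i k hk => by
    rcases eq_or_ne k k₀ with rfl | hne
    · simpa using h2
    · rw [Function.update_of_ne hne]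
      exact B.le_len i k (by omega)
  len_le := fun i k hk => by
    rcases eq_or_ne k k₀ with rfl | hne
    · simpa using h1
    · rw [Function.update_of_ne hne]
      exact B.len_le i k (by omega)
  mem_unit := fun i k hk t ht => by
    rcases eq_or_ne k k₀ with rfl | hne
    · simpa using ht
    · rw [Function.update_of_ne hne, Function.update_of_ne hne]
      exact B.mem_unit i k (by omega) t ht
  meets := fun i => by
    obtain ⟨x, hx, h⟩ := B.meets i
    refine ⟨x, hx, fun k hk => ?_⟩
    rcases eq_or_ne k k₀ with rfl | hne
    · exact ⟨x (σ k), hR x hx _, by simp⟩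
    · rw [Function.update_of_ne hne, Function.update_of_ne hne]
      exact h k (by omega)
  covers := fun x hx => by
    obtain ⟨i, h⟩ := B.covers x hx
    refine ⟨i, fun k hk => ?_⟩
    rcases eq_or_ne k k₀ with rfl | hne
    · exact ⟨x (σ k), hR x hx _, by simp⟩
    · rw [Function.update_of_ne hne, Function.update_of_ne hne]
      exact h k (by omega)
  disj := fun i i' hi t t' ht ht' => by
    obtain ⟨k, hk, h⟩ := B.disj i i' hi t t' ht ht'
    have hne : k ≠ k₀ := fun h => by simp [h] at hk
    refine ⟨k, by omega, ?_⟩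
    simpa only [Function.update_of_ne hne] using h
  -- The new side has length `1`, so its factor is `1` whatever the exponent.
  mass := by
    refine Eq.trans (Finset.sum_congr rfl fun i _ => ?_) B.mass
    rw [lowRanks_succ, Finset.prod_insert (by simp [mem_lowRanks])]
    simp only [Function.update_self, abs_one, Real.one_rpow, one_mul]
    refine Finset.prod_congr rfl fun k hk => ?_
    have hne : k ≠ k₀ := fun h => by simp [h, mem_lowRanks] at hk
    rw [Function.update_of_ne hne]

/-- Gluing of the images of box families under diagonal maps with disjoint images. -/
noncomputable def glue {κ : Type} [Fintype κ] (f : κ → Fin d → ContractingSimilarity)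
    {R : Set (EuclideanSpace ℝ (Fin d))} {S : κ → Set (EuclideanSpace ℝ (Fin d))} {m : κ → ℝ}
    (hin : ∀ a, ∀ y ∈ S a, ∃ x ∈ R, ∀ k : Fin d, (k : ℕ) < j → x (σ k) = (f a k).toFun (y (σ k)))
    (hout : ∀ x ∈ R, ∃ a, ∃ y ∈ S a, ∀ k : Fin d, (k : ℕ) < j →
      x (σ k) = (f a k).toFun (y (σ k)))
    (hdisj : ∀ a a', a ≠ a' → ∀ t t' : Fin d → ℝ, (∀ k : Fin d, (k : ℕ) < j → t k ∈ Ioo (0 : ℝ) 1) →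
      (∀ k : Fin d, (k : ℕ) < j → t' k ∈ Ioo (0 : ℝ) 1) →
      ∃ k : Fin d, (k : ℕ) < j ∧ (f a k).toFun (t k) ≠ (f a' k).toFun (t' k))
    (B : ∀ a, BoxFamily σ β c j (fun k => s k / |(f a k).slope|) (S a) (m a)) :
    BoxFamily σ β c j s R (∑ a, (∏ k ∈ lowRanks d j, |(f a k).slope| ^ β k) * m a) where
  ι := Σ a, (B a).ι
  fintype := inferInstance
  len := fun i k => (f i.1 k).slope * (B i.1).len i.2 k
  off := fun i k => (f i.1 k).toFun ((B i.1).off i.2 k)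
  le_len := fun i k hk => by
    have h := (B i.1).le_len i.2 k hk
    have hs := abs_pos.2 (f i.1 k).slope_ne_zero
    rw [← mul_div_assoc, div_le_iff₀ hs] at h
    rw [abs_mul]
    linarith
  len_le := fun i k hk => by
    have h := (B i.1).len_le i.2 k hk
    have hs := abs_pos.2 (f i.1 k).slope_ne_zero
    rw [le_div_iff₀ hs] at h
    rw [abs_mul]
    linarith
  mem_unit := fun i k hk t ht => by
    have h := (f i.1 k).toFun_mem_Ioo ((B i.1).mem_unit i.2 k hk t ht)
    convert h using 1
    simp only [ContractingSimilarity.toFun]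
    ring
  meets := fun i => by
    obtain ⟨y, hy, h⟩ := (B i.1).meets i.2
    obtain ⟨x, hx, hxy⟩ := hin i.1 y hy
    refine ⟨x, hx, fun k hk => ?_⟩
    obtain ⟨t, ht, hyt⟩ := h k hk
    refine ⟨t, ht, ?_⟩
    rw [hxy k hk, hyt]
    simp only [ContractingSimilarity.toFun]
    ring
  covers := fun x hx => by
    obtain ⟨a, y, hy, hxy⟩ := hout x hx
    obtain ⟨i, h⟩ := (B a).covers y hy
    refine ⟨⟨a, i⟩, fun k hk => ?_⟩
    obtain ⟨t, ht, hyt⟩ := h k hk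
    refine ⟨t, ht, ?_⟩
    rw [hxy k hk, hyt]
    simp only [ContractingSimilarity.toFun]
    ring
  disj := by
    rintro ⟨a, i⟩ ⟨a', i'⟩ hne t t' ht ht'
    have key : ∀ b (i : (B b).ι) (t : Fin d → ℝ) (k : Fin d),
        (f b k).slope * (B b).len i k * t k + (f b k).toFun ((B b).off i k) =
        (f b k).toFun ((B b).len i k * t k + (B b).off i k) := by
      intro b i t k
      simp only [ContractingSimilarity.toFun]
      ring
    -- Within one image, injectivity of the map transports disjointness; between two images, `hdisj`
    -- applies to points of the open cube.
    rcases eq_or_ne a a' with rfl | ha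
    · obtain ⟨k, hk, h⟩ := (B a).disj i i' (fun h => hne (by rw [h])) t t' ht ht'
      refine ⟨k, hk, fun heq => h ?_⟩
      simp only [key] at heq
      simp only [ContractingSimilarity.toFun, add_left_inj] at heq
      exact mul_left_cancel₀ (f a k).slope_ne_zero heq
    · obtain ⟨k, hk, h⟩ := hdisj a a' ha _ _
        (fun k hk => (B a).mem_unit i k hk (t k) (ht k))
        (fun k hk => (B a').mem_unit i' k hk (t' k) (ht' k))
      exact ⟨k, hk, by simpa only [key] using h⟩
  mass := by
    rw [Fintype.sum_sigma]
    refine Finset.sum_congr rfl fun a _ => ?_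
    refine Eq.trans ?_ (congrArg _ (B a).mass)
    rw [Finset.mul_sum]
    refine Finset.sum_congr rfl fun i _ => ?_
    rw [← Finset.prod_mul_distrib]
    refine Finset.prod_congr rfl fun k _ => ?_
    rw [abs_mul, Real.mul_rpow (abs_nonneg _) (abs_nonneg _)]

end BoxFamily

end DiagonalIFS

/-! ### Box families of the whole sponge -/

namespace DiagonalIFS

variable {d : ℕ} (Φ : DiagonalIFS d)

theorem exists_slope_bounds : ∃ c ρ : ℝ, 0 < c ∧ 0 < ρ ∧ ρ < 1 ∧
    ∀ a ∈ Φ.digits, ∀ i, c ≤ |(a i).slope| ∧ |(a i).slope| ≤ ρ := by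
  classical
  obtain ⟨q, hq1, hq⟩ := Φ.exists_ratio
  let S : Finset ℝ := Φ.digits.biUnion fun a => Finset.univ.image fun i => |(a i).slope|
  have hmem : ∀ a ∈ Φ.digits, ∀ i, |(a i).slope| ∈ S := fun a ha i => by
    simp only [S, Finset.mem_biUnion, Finset.mem_image, Finset.mem_univ, true_and]
    exact ⟨a, ha, i, rfl⟩
  have hpos : ∀ x ∈ S, 0 < x ∧ x < 1 := fun x hx => by
    simp only [S, Finset.mem_biUnion, Finset.mem_image, Finset.mem_univ, true_and] at hx
    obtain ⟨a, -, i, rfl⟩ := hx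
    exact ⟨abs_pos.2 (a i).slope_ne_zero, (a i).abs_slope_lt_one⟩
  rcases S.eq_empty_or_nonempty with hS | hS
  -- This case means `d = 0`, where any constants serve.
  · refine ⟨1 / 2, 1 / 2, by norm_num, by norm_num, by norm_num, fun a ha i => ?_⟩
    simpa [hS] using hmem a ha i
  · refine ⟨S.min' hS, S.max' hS, (hpos _ (S.min'_mem hS)).1, (hpos _ (S.max'_mem hS)).1,
      (hpos _ (S.max'_mem hS)).2, fun a ha i => ⟨S.min'_le _ (hmem a ha i), S.le_max' _ (hmem a ha i)⟩⟩

variable {Φ} {σ : Equiv.Perm (Fin d)}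

/-- This is where the ordering of the slopes enters: later ranks contract more, so pulling targets
back by a digit keeps them increasing. -/
theorem CoordinateOrdering.monotone_div (hord : Φ.CoordinateOrdering σ)
    {a : Fin d → ContractingSimilarity} (ha : a ∈ Φ.digits) {s : Fin d → ℝ} (h0 : ∀ k, 0 < s k)
    (hs : Monotone s) : Monotone fun k => s k / |(a (σ k)).slope| := by
  intro k l hkl
  rcases hkl.eq_or_lt with rfl | hlt
  · exact le_rfl
  · exact div_le_div₀ (h0 l).le (hs hkl) (abs_pos.2 (a (σ l)).slope_ne_zero) (hord a ha k l hlt).le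

theorem NeatProjection.exists_ne (hneat : Φ.NeatProjection σ) (j : Fin d)
    {a b : Fin d → ContractingSimilarity} (ha : a ∈ Φ.digits) (hb : b ∈ Φ.digits)
    (hne : (fun k : Iic j => a (σ k)) ≠ fun k : Iic j => b (σ k)) {t u : Fin d → ℝ}
    (ht : ∀ k : Fin d, (k : ℕ) < j + 1 → t k ∈ Ioo (0 : ℝ) 1)
    (hu : ∀ k : Fin d, (k : ℕ) < j + 1 → u k ∈ Ioo (0 : ℝ) 1) :
    ∃ k : Fin d, (k : ℕ) < j + 1 ∧ (a (σ k)).toFun (t k) ≠ (b (σ k)).toFun (u k) := by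
  classical
  have hmem : ∀ k : Iic j, ((k : Fin d) : ℕ) < j + 1 := fun k => Nat.lt_succ_of_le k.2
  by_contra! h
  refine Set.disjoint_left.1 (hneat j _ (Finset.mem_image_of_mem _ ha) _
    (Finset.mem_image_of_mem _ hb) hne) (mem_image_of_mem _ (?_ : (fun k : Iic j => t k) ∈ _))
    ⟨fun k : Iic j => u k, ?_, ?_⟩
  · exact fun k _ => ht k (hmem k)
  · exact fun k _ => hu k (hmem k)
  · exact funext fun k => (h k (hmem k)).symm

theorem prod_lowRanks_succ (j : Fin d) (w : Fin d → ℝ) :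
    ∏ k ∈ lowRanks d (j + 1), w k = ∏ k : Iic j, w k := by
  rw [← Finset.prod_subtype (p := fun k => k ∈ Iic j)]
  intro k
  rw [mem_lowRanks, mem_Iic, Fin.le_def, Nat.lt_succ_iff]

/-- Subdivision of the approximate cubes of the projected sponge by the projected system. -/
theorem nonempty_boxFamily_of_div (hneat : Φ.NeatProjection σ) {c : ℝ} (j : Fin d) {s : Fin d → ℝ}
    (h : ∀ a ∈ Φ.digits, Nonempty (BoxFamily σ (Φ.exponents σ) c (j + 1)
      (fun k => s k / |(a (σ k)).slope|) Φ.sponge 1)) :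
    Nonempty (BoxFamily σ (Φ.exponents σ) c (j + 1) s Φ.sponge 1) := by
  classical
  -- Several digits may project to the same map. One representative of each is enough, since only
  -- the coordinates of rank at most `j` are looked at; distinct projected maps are thus counted
  -- once, as in the equation for `β_j`.
  have hrep : ∀ f : Φ.proj σ j, ∃ a ∈ Φ.digits, (fun k : Iic j => a (σ k)) = f := fun f => by
    simpa using Finset.mem_image.1 f.2
  choose r hr hrf using hrep
  have hmass : ∑ f : Φ.proj σ j,
      (∏ k ∈ lowRanks d (j + 1), |(r f (σ k)).slope| ^ Φ.exponents σ k) * 1 = 1 := by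
    have hE := Φ.exponents_spec σ j
    rw [← Finset.sum_coe_sort] at hE
    refine Eq.trans (Finset.sum_congr rfl fun f _ => ?_) hE
    rw [mul_one, prod_lowRanks_succ]
    refine Finset.prod_congr rfl fun k _ => ?_
    rw [← congrFun (hrf f) k]
  have := BoxFamily.glue (σ := σ) (β := Φ.exponents σ) (c := c) (j := j + 1) (s := s)
    (fun (f : Φ.proj σ j) k => r f (σ k)) (R := Φ.sponge) (S := fun _ => Φ.sponge) (m := fun _ => 1)
    (fun f y hy => ⟨_, Φ.diagMap_mem_sponge (hr f) hy, fun k _ => rfl⟩)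
    (fun x hx => by
      obtain ⟨a, ha, y, hy, rfl⟩ := Φ.exists_digit_of_mem_sponge hx
      refine ⟨⟨_, Finset.mem_image_of_mem _ ha⟩, y, hy, fun k hk => ?_⟩
      have := congrFun (hrf ⟨_, Finset.mem_image_of_mem _ ha⟩) ⟨k, Nat.lt_succ_iff.1 hk⟩
      simp only at this
      rw [this]
      rfl)
    (fun f g hfg t u ht hu => hneat.exists_ne j (hr f) (hr g)
      (fun h => hfg (Subtype.ext (by rw [← hrf f, ← hrf g, h]))) ht hu)
    (fun f => (h _ (hr f)).some)
  rw [hmass] at this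
  exact ⟨this⟩

/-- Induction on the number of coordinates, and inside it on the number of cuts. The bound `c * s k
≤ 1` permits a side of length `1` once the last target has reached `1`. -/
theorem nonempty_boxFamily_sponge (hord : Φ.CoordinateOrdering σ) (hneat : Φ.NeatProjection σ)
    {c ρ : ℝ} (hc : 0 < c) (hρ0 : 0 < ρ) (hρ1 : ρ < 1)
    (hb : ∀ a ∈ Φ.digits, ∀ i, c ≤ |(a i).slope| ∧ |(a i).slope| ≤ ρ) :
    ∀ j ≤ d, ∀ s : Fin d → ℝ, (∀ k, 0 < s k) → Monotone s →
      (∀ k : Fin d, (k : ℕ) < j → c * s k ≤ 1) →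
      Nonempty (BoxFamily σ (Φ.exponents σ) c j s Φ.sponge 1) := by
  intro j
  induction j with
  | zero => exact fun _ s _ _ _ => ⟨BoxFamily.point Φ.sponge_isInvariant.1⟩
  | succ j ih =>
    intro hj
    let k₀ : Fin d := ⟨j, hj⟩
    have hlarge : ∀ s : Fin d → ℝ, (∀ k, 0 < s k) → Monotone s →
        (∀ k : Fin d, (k : ℕ) < j + 1 → c * s k ≤ 1) → 1 ≤ s k₀ →
        Nonempty (BoxFamily σ (Φ.exponents σ) c (j + 1) s Φ.sponge 1) := by
      intro s h0 hs h1 hk₀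
      obtain ⟨B⟩ := ih (Nat.le_of_succ_le hj) s h0 hs fun k hk => h1 k (by omega)
      exact ⟨BoxFamily.adjoin k₀ (fun x hx i => Φ.sponge_coord_mem hx i) hk₀
        (h1 k₀ (Nat.lt_succ_self j)) B⟩
    -- A cut multiplies the last target by at least `ρ⁻¹`, so `n` cuts suffice when `ρ ^ n ≤ s k₀`.
    have hsteps : ∀ n : ℕ, ∀ s : Fin d → ℝ, (∀ k, 0 < s k) → Monotone s →
        (∀ k : Fin d, (k : ℕ) < j + 1 → c * s k ≤ 1) → ρ ^ n ≤ s k₀ →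
        Nonempty (BoxFamily σ (Φ.exponents σ) c (j + 1) s Φ.sponge 1) := by
      intro n
      induction n with
      | zero => exact fun s h0 hs h1 hn => hlarge s h0 hs h1 (by simpa using hn)
      | succ n ihn =>
        intro s h0 hs h1 hn
        rcases le_or_gt 1 (s k₀) with hk₀ | hk₀
        · exact hlarge s h0 hs h1 hk₀
        refine nonempty_boxFamily_of_div hneat k₀ fun a ha => ihn _ (fun k => ?_) ?_ ?_ ?_
        · exact div_pos (h0 k) (abs_pos.2 (a (σ k)).slope_ne_zero)
        · exact hord.monotone_div ha h0 hs
        · intro k hk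
          -- Monotonicity gives `s k < 1` for every coordinate in play, so dividing by a slope of
          -- size at least `c` cannot exceed `1 / c`.
          have h2 : s k ≤ s k₀ := hs (Nat.lt_succ_iff.1 hk)
          have h3 := (hb a ha (σ k)).1
          rw [← mul_div_assoc, div_le_one (hc.trans_le h3)]
          nlinarith [h0 k]
        · have h3 := hb a ha (σ k₀)
          rw [le_div_iff₀ (hc.trans_le h3.1)]
          refine le_trans ?_ hn
          rw [pow_succ]
          exact mul_le_mul_of_nonneg_left h3.2 (by positivity)
    intro s h0 hs h1
    obtain ⟨n, hn⟩ := exists_pow_lt_of_lt_one (h0 k₀) hρ1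
    exact hsteps n s h0 hs h1 hn.le

/-! ### Self-similarity of the Bernoulli measure -/

variable (Φ σ)

/-- Prepending a digit to a sequence of digits. -/
def consSeq (p : Φ.Letter × (ℕ → Φ.Letter)) : ℕ → Φ.Letter := fun n => Nat.casesOn n p.1 p.2

theorem measurable_consSeq : Measurable Φ.consSeq := by
  refine measurable_pi_lambda _ fun n => ?_
  cases n with
  | zero => exact measurable_fst
  | succ n => exact (measurable_pi_apply n).comp measurable_snd

/-- The product measure on sequences of digits. -/
noncomputable def seqLaw : Measure (ℕ → Φ.Letter) :=
  Measure.infinitePi fun _ : ℕ => (Φ.letterLaw σ).toMeasure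

instance : IsProbabilityMeasure (Φ.seqLaw σ) := by
  unfold seqLaw
  infer_instance

/-- The first letter is independent of the shifted sequence, which has the same law. It suffices to
check this on finite-dimensional boxes. -/
theorem map_consSeq : (((Φ.letterLaw σ).toMeasure).prod (Φ.seqLaw σ)).map Φ.consSeq =
    Φ.seqLaw σ := by
  classical
  refine Measure.eq_infinitePi _ fun s t ht => ?_
  obtain ⟨N, hN⟩ : ∃ N, s ⊆ Finset.range (N + 1) := by
    obtain ⟨N, hN⟩ := s.exists_nat_subset_range
    exact ⟨N, hN.trans (Finset.range_mono (Nat.le_succ N))⟩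
  -- Padding with `univ` makes the index set an initial segment, which splits cleanly into the index
  -- `0` and a shifted segment.
  let t' : ℕ → Set Φ.Letter := fun n => if n ∈ s then t n else univ
  have ht' : ∀ n, MeasurableSet (t' n) := fun n => by
    simp only [t']
    split_ifs
    · exact ht n
    · exact MeasurableSet.univ
  have h1 : Set.pi (s : Set ℕ) t = Set.pi (Finset.range (N + 1) : Set ℕ) t' := by
    ext ω
    simp only [Set.mem_pi, Finset.mem_coe, t']
    constructor
    · intro h n _
      split_ifs with hn
      · exact h n hn
      · exact mem_univ _
    · intro h n hn
      simpa [hn] using h n (hN hn)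
  have h2 : ∏ i ∈ s, (Φ.letterLaw σ).toMeasure (t i) =
      ∏ i ∈ Finset.range (N + 1), (Φ.letterLaw σ).toMeasure (t' i) := by
    rw [← Finset.prod_subset hN]
    · exact Finset.prod_congr rfl fun i hi => by simp [t', hi]
    · intro i _ hi
      simp [t', hi]
  have h3 : Φ.consSeq ⁻¹' Set.pi (Finset.range (N + 1) : Set ℕ) t' =
      t' 0 ×ˢ Set.pi (Finset.range N : Set ℕ) fun n => t' (n + 1) := by
    ext ⟨a, ω⟩
    simp only [mem_preimage, Set.mem_pi, Finset.mem_coe, Finset.mem_range, mem_prod]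
    constructor
    · exact fun h => ⟨h 0 (Nat.succ_pos N), fun n hn => h (n + 1) (Nat.succ_lt_succ hn)⟩
    · rintro ⟨h0, h⟩ (_ | n) hn
      · exact h0
      · exact h n (Nat.lt_of_succ_lt_succ hn)
  rw [h2, h1, Measure.map_apply Φ.measurable_consSeq
    (MeasurableSet.pi (Finset.countable_toSet _) fun i _ => ht' i), h3, Measure.prod_prod, seqLaw,
    Measure.infinitePi_pi _ fun i _ => ht' (i + 1), Finset.prod_range_succ', mul_comm]

theorem wordMap_consSeq (a : Φ.Letter) (ω : ℕ → Φ.Letter) (n : ℕ) (x : EuclideanSpace ℝ (Fin d)) :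
    Φ.wordMap (Φ.consSeq (a, ω)) (n + 1) x = diagMap a.1 (Φ.wordMap ω n x) := by
  induction n generalizing x with
  | zero => rfl
  | succ n ih => exact ih _

theorem coding_consSeq (a : Φ.Letter) (ω : ℕ → Φ.Letter) :
    (Φ.coding (Φ.consSeq (a, ω)) : EuclideanSpace ℝ (Fin d)) = diagMap a.1 (Φ.coding ω) := by
  have hcont : Continuous (diagMap a.1) :=
    (lipschitzWith_diagMap a.1 1 fun i => by simpa using (a.1 i).abs_slope_lt_one.le).continuous
  refine tendsto_nhds_unique
    ((tendsto_add_atTop_iff_nat 1).2 (Φ.tendsto_coding (Φ.consSeq (a, ω)) 0)) ?_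
  simp only [wordMap_consSeq]
  exact (hcont.tendsto _).comp (Φ.tendsto_coding ω 0)

/-- The Bernoulli measure as a real-valued function of sets of `ℝ^d`. -/
noncomputable def mass (R : Set (EuclideanSpace ℝ (Fin d))) : ℝ :=
  (Φ.seqLaw σ).real {ω | (Φ.coding ω : EuclideanSpace ℝ (Fin d)) ∈ R}

/-- Conditioning on the first letter. The computation takes place on sequences, so overlaps between
the pieces `φ_a(Λ)` cause no trouble. -/
theorem mass_eq_sum {R : Set (EuclideanSpace ℝ (Fin d))} (hR : MeasurableSet R) :
    Φ.mass σ R = ∑ a : Φ.Letter, Φ.weight σ a * Φ.mass σ (diagMap a.1 ⁻¹' R) := by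
  have hm : MeasurableSet {ω | (Φ.coding ω : EuclideanSpace ℝ (Fin d)) ∈ R} :=
    (measurable_subtype_coe.comp Φ.measurable_coding) hR
  have hsing : MeasurableSingletonClass Φ.Letter := ⟨fun _ => trivial⟩
  have h : (Φ.seqLaw σ) {ω | (Φ.coding ω : EuclideanSpace ℝ (Fin d)) ∈ R} =
      ∑ a : Φ.Letter, ENNReal.ofReal (Φ.weight σ a) *
        (Φ.seqLaw σ) {ω | (Φ.coding ω : EuclideanSpace ℝ (Fin d)) ∈ diagMap a.1 ⁻¹' R} := by
    conv_lhs => rw [← map_consSeq]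
    rw [Measure.map_apply Φ.measurable_consSeq hm, Measure.prod_apply (Φ.measurable_consSeq hm),
      lintegral_fintype]
    refine Finset.sum_congr rfl fun a _ => ?_
    rw [mul_comm, PMF.toMeasure_apply_singleton _ _ (hsing.measurableSet_singleton a)]
    congr 1
    refine congrArg _ ?_
    ext ω
    simp only [mem_preimage, mem_ofPred_eq, coding_consSeq]
  rw [mass, Measure.real, h, ENNReal.toReal_sum]
  · refine Finset.sum_congr rfl fun a _ => ?_
    rw [ENNReal.toReal_mul, ENNReal.toReal_ofReal (Φ.weight_nonneg σ a)]
    rfl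
  · exact fun a _ => ENNReal.mul_ne_top ENNReal.ofReal_ne_top (measure_ne_top _ _)

theorem mass_of_sponge_subset {R : Set (EuclideanSpace ℝ (Fin d))} (h : Φ.sponge ⊆ R) :
    Φ.mass σ R = 1 := by
  have : {ω | (Φ.coding ω : EuclideanSpace ℝ (Fin d)) ∈ R} = univ :=
    eq_univ_of_forall fun ω => h (Φ.coding ω).2
  rw [mass, this]
  simp

theorem mass_of_disjoint {R : Set (EuclideanSpace ℝ (Fin d))} (h : Φ.sponge ∩ R = ∅) :
    Φ.mass σ R = 0 := by
  have : {ω | (Φ.coding ω : EuclideanSpace ℝ (Fin d)) ∈ R} = ∅ :=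
    eq_empty_of_forall_notMem fun ω hω => (h ▸ mem_inter (Φ.coding ω).2 hω : _ ∈ (∅ : Set _))
  rw [mass, this]
  simp

/-! ### Box families of separated pieces of the sponge -/

variable {Φ σ}

/-- Approximate cubes for those parts `R` of the sponge that contain, with each of their points,
all the points of the sponge at distance at most `q ^ n * D`. -/
theorem nonempty_boxFamily_inter (hd : 1 ≤ d) (hord : Φ.CoordinateOrdering σ)
    (hneat : Φ.NeatProjection σ) {c ρ : ℝ} (hc : 0 < c) (hρ0 : 0 < ρ) (hρ1 : ρ < 1)
    (hb : ∀ a ∈ Φ.digits, ∀ i, c ≤ |(a i).slope| ∧ |(a i).slope| ≤ ρ)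
    {D : ℝ} (hD : ∀ x ∈ Φ.sponge, ∀ y ∈ Φ.sponge, dist x y ≤ D) (n : ℕ) :
    ∀ R : Set (EuclideanSpace ℝ (Fin d)), MeasurableSet R →
      (∀ x ∈ Φ.sponge, ∀ y ∈ Φ.sponge, dist x y ≤ ρ ^ n * D → x ∈ R → y ∈ R) →
      ∀ s : Fin d → ℝ, (∀ k, 0 < s k) → Monotone s → (∀ k, s k ≤ c ^ n) →
      Nonempty (BoxFamily σ (Φ.exponents σ) c d s (Φ.sponge ∩ R) (Φ.mass σ R)) := by
  induction n with
  | zero =>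
    intro R _ hR s h0 hs h1
    rcases (Φ.sponge ∩ R).eq_empty_or_nonempty with h | ⟨x, hx, hxR⟩
    · rw [Φ.mass_of_disjoint σ h, h]
      exact ⟨BoxFamily.empty⟩
    -- For `n = 0` the saturation distance is `D`, a bound for all distances in the sponge, so one
    -- point of `R` brings in everything.
    · have hsub : Φ.sponge ⊆ R := fun y hy => hR x hx y hy (by simpa using hD x hx y hy) hxR
      rw [Φ.mass_of_sponge_subset σ hsub, inter_eq_left.2 hsub]
      refine nonempty_boxFamily_sponge hord hneat hc hρ0 hρ1 hb d le_rfl s h0 hs fun k _ => ?_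
      -- A digit is needed to know `c ≤ ρ < 1`, which turns `s k ≤ 1` into `c * s k ≤ 1`.
      obtain ⟨a, ha⟩ := Φ.digits_nonempty
      have h2 := h1 k
      have h3 := hb a ha k
      simp only [pow_zero] at h2
      nlinarith [h0 k]
  | succ n ih =>
    intro R hRm hR s h0 hs h1
    -- The last rank: projecting to all coordinates loses nothing, so distinct digits have disjoint
    -- open images.
    let j : Fin d := ⟨d - 1, by omega⟩
    have hj : (j : ℕ) + 1 = d := Nat.sub_add_cancel hd
    have hcont : ∀ a : Fin d → ContractingSimilarity, Continuous (diagMap a) := fun a =>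
      (lipschitzWith_diagMap a 1 fun i => by simpa using (a i).abs_slope_lt_one.le).continuous
    have hB : ∀ a : Φ.Letter, Nonempty (BoxFamily σ (Φ.exponents σ) c d
        (fun k => s k / |(a.1 (σ k)).slope|) (Φ.sponge ∩ diagMap a.1 ⁻¹' R)
        (Φ.mass σ (diagMap a.1 ⁻¹' R))) := by
      intro a
      -- The preimage is saturated at distance `ρ ^ n * D` because the digit contracts by `ρ`; its
      -- targets stay below `c ^ n` because slopes are at least `c`.
      refine ih _ ((hcont a.1).measurable hRm) (fun x hx y hy hxy hxR => ?_) _ (fun k => ?_)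
        (hord.monotone_div a.2 h0 hs) fun k => ?_
      · refine hR _ (Φ.diagMap_mem_sponge a.2 hx) _ (Φ.diagMap_mem_sponge a.2 hy) ?_ hxR
        refine ((lipschitzWith_diagMap a.1 ⟨ρ, hρ0.le⟩ fun i => (hb a.1 a.2 i).2).dist_le_mul
          x y).trans ?_
        rw [pow_succ', mul_assoc]
        exact mul_le_mul_of_nonneg_left hxy hρ0.le
      · exact div_pos (h0 k) (abs_pos.2 (a.1 (σ k)).slope_ne_zero)
      · have h3 := (hb a.1 a.2 (σ k)).1
        rw [div_le_iff₀ (hc.trans_le h3)]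
        refine (h1 k).trans ?_
        rw [pow_succ]
        exact mul_le_mul_of_nonneg_left h3 (by positivity)
    have hglue := BoxFamily.glue (σ := σ) (β := Φ.exponents σ) (c := c) (j := d) (s := s)
      (fun (a : Φ.Letter) k => a.1 (σ k)) (R := Φ.sponge ∩ R)
      (S := fun a => Φ.sponge ∩ diagMap a.1 ⁻¹' R)
      (fun a y hy => ⟨_, ⟨Φ.diagMap_mem_sponge a.2 hy.1, hy.2⟩, fun k _ => rfl⟩)
      (fun x hx => by
        obtain ⟨a, ha, y, hy, rfl⟩ := Φ.exists_digit_of_mem_sponge hx.1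
        exact ⟨⟨a, ha⟩, y, ⟨hy, hx.2⟩, fun k _ => rfl⟩)
      (fun a b hab t u ht hu => by
        have := hneat.exists_ne j a.2 b.2 (fun h => hab (Subtype.ext (funext fun i => ?_)))
          (t := t) (u := u) (fun k _ => ht k k.2) (fun k _ => hu k k.2)
        · obtain ⟨k, -, hk⟩ := this
          exact ⟨k, k.2, hk⟩
        · have := congrFun h ⟨σ.symm i, by
            rw [mem_Iic, Fin.le_def]
            omega⟩
          simpa using this)
      (fun a => (hB a).some)
    rw [Φ.mass_eq_sum σ hRm]
    simp only [lowRanks_self] at hglue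
    exact ⟨hglue⟩

end DiagonalIFS

/-! ### Packing numbers against numbers of boxes -/

theorem packingCards_nonempty {X : Type*} [MetricSpace X] (δ : ℝ) (A : Set X) :
    (packingCards δ A).Nonempty := ⟨0, ∅, by simp, by simp, rfl⟩

/-- A packing of maximal cardinality is `2δ`-dense. -/
theorem exists_packing_dense {X : Type*} [MetricSpace X] [CompactSpace X] {δ : ℝ} (hδ : 0 < δ)
    (A : Set X) : ∃ P : Finset X, P.card = ballPackingNumber δ A ∧
      ∀ x ∈ A, ∃ p ∈ P, dist x p < 2 * δ := by
  classical
  have hbdd := bddAbove_packingCards hδ A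
  obtain ⟨P, hPA, hP, hcard⟩ := Nat.sSup_mem (packingCards_nonempty δ A) hbdd
  refine ⟨P, hcard, fun x hx => ?_⟩
  by_contra! h
  have hxP : x ∉ P := fun hxP => by
    have := h x hxP
    rw [dist_self] at this
    linarith
  have hmem : (insert x P).card ∈ packingCards δ A := by
    refine ⟨insert x P, ?_, ?_, rfl⟩
    · rw [Finset.coe_insert]
      exact insert_subset hx hPA
    · rw [Finset.coe_insert]
      refine hP.insert fun p hp _ => Metric.ball_disjoint_ball ?_
      linarith [h p hp]
  have hle := le_csSup hbdd hmem
  rw [Finset.card_insert_of_notMem hxP, hcard] at hle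
  omega

namespace DiagonalIFS

variable {d : ℕ} {Φ : DiagonalIFS d} {σ : Equiv.Perm (Fin d)} {β : Fin d → ℝ} {c δ m : ℝ}

instance : CompactSpace Φ.sponge := isCompact_iff_compactSpace.1 Φ.isCompact_sponge

theorem abs_sub_coord_le_dist (x y : EuclideanSpace ℝ (Fin d)) (i : Fin d) :
    |x i - y i| ≤ dist x y := by
  rw [dist_eq_norm]
  simpa using PiLp.norm_apply_le (x - y) i

/-- The divisor `d + 1` in place of `√d` makes the inequality strict and covers `d = 0`. -/
theorem dist_lt_of_coord_le {x y : EuclideanSpace ℝ (Fin d)} (hδ : 0 < δ)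
    (h : ∀ i, |x i - y i| ≤ δ / (d + 1)) : dist x y < δ := by
  rw [EuclideanSpace.dist_eq, Real.sqrt_lt' hδ]
  calc ∑ i, dist (x i) (y i) ^ 2 ≤ ∑ _i : Fin d, (δ / (d + 1)) ^ 2 :=
        Finset.sum_le_sum fun i _ => pow_le_pow_left₀ dist_nonneg (h i) 2
    _ = d * (δ / (d + 1)) ^ 2 := by simp
    _ < δ ^ 2 := by
        rw [div_pow, ← mul_div_assoc, div_lt_iff₀ (by positivity), mul_comm]
        have : (d : ℝ) < (d + 1) ^ 2 := by nlinarith [(Nat.cast_nonneg d : (0 : ℝ) ≤ d)]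
        exact mul_lt_mul_of_pos_left this (by positivity)

/-- Two points in one box of side at most `δ / (d + 1)` are less than `δ` apart, so a `δ`-packing
has at most one centre per box. -/
theorem BoxFamily.ballPackingNumber_le (hδ : 0 < δ) {R : Set Φ.sponge}
    (B : BoxFamily σ β c d (fun _ => δ / (d + 1)) (Subtype.val '' R) m) :
    ballPackingNumber δ R ≤ Fintype.card B.ι := by
  refine csSup_le (packingCards_nonempty δ R) ?_
  rintro n ⟨P, hPR, hP, rfl⟩
  have hex : ∀ x : P, ∃ i : B.ι, ∀ k : Fin d, ∃ t ∈ Icc (0 : ℝ) 1,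
      (x.1 : EuclideanSpace ℝ (Fin d)) (σ k) = B.len i k * t + B.off i k := fun x => by
    obtain ⟨i, hi⟩ := B.covers x.1 (mem_image_of_mem _ (hPR x.2))
    exact ⟨i, fun k => hi k k.2⟩
  choose g hg using hex
  rw [← Fintype.card_coe]
  refine Fintype.card_le_of_injective g fun x y hxy => ?_
  by_contra hne
  refine Set.disjoint_left.1 (hP x.2 y.2 fun h => hne (Subtype.ext h))
    (Metric.mem_ball_self hδ) ?_
  refine dist_lt_of_coord_le hδ fun i => ?_
  obtain ⟨k, rfl⟩ := σ.surjective i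
  obtain ⟨t, ht, hxt⟩ := hg x k
  obtain ⟨u, hu, hyu⟩ := hg y k
  rw [hxt, hyu, ← hxy, add_sub_add_right_eq_sub, ← mul_sub, abs_mul]
  refine (mul_le_of_le_one_right (abs_nonneg _) ?_).trans (B.len_le (g x) k k.2)
  exact abs_le.2 ⟨by linarith [ht.1, hu.2], by linarith [ht.2, hu.1]⟩

/-- Volume comparison: the open boxes are disjoint with volume at least `(c δ) ^ d`, and all lie in
the cubes of side `6 δ` around the centres of a maximal packing. -/
theorem BoxFamily.card_mul_le (hc : 0 < c) (hδ : 0 < δ) {R : Set Φ.sponge}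
    (B : BoxFamily σ β c d (fun _ => δ) (Subtype.val '' R) m) :
    (Fintype.card B.ι : ℝ) * (c * δ) ^ d ≤ ballPackingNumber δ R * (6 * δ) ^ d := by
  classical
  obtain ⟨P, hPcard, hP⟩ := exists_packing_dense hδ R
  -- Midpoint minus and plus half the length: endpoints in the right order for either sign of `len`.
  let a : B.ι → Fin d → ℝ := fun i k => B.len i k / 2 + B.off i k - |B.len i k| / 2
  let b : B.ι → Fin d → ℝ := fun i k => B.len i k / 2 + B.off i k + |B.len i k| / 2
  let O : B.ι → Set (Fin d → ℝ) := fun i => univ.pi fun k => Ioo (a i k) (b i k)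
  -- Radius `3 δ`: at most `δ` across the box to a point of `R`, then less than `2 δ` to a centre.
  let Q : Φ.sponge → Set (Fin d → ℝ) := fun p => univ.pi fun k =>
    Ioo ((p : EuclideanSpace ℝ (Fin d)) (σ k) - 3 * δ)
      ((p : EuclideanSpace ℝ (Fin d)) (σ k) + 3 * δ)
  have hlen : ∀ i k, c * δ ≤ |B.len i k| ∧ |B.len i k| ≤ δ := fun i k =>
    ⟨B.le_len i k k.2, B.len_le i k k.2⟩
  have hO : ∀ i, ∀ y ∈ O i, ∃ t : Fin d → ℝ, (∀ k, t k ∈ Ioo (0 : ℝ) 1) ∧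
      ∀ k, y k = B.len i k * t k + B.off i k := by
    intro i y hy
    have hne : ∀ k, B.len i k ≠ 0 := fun k => abs_pos.1 ((mul_pos hc hδ).trans_le (hlen i k).1)
    refine ⟨fun k => (y k - B.off i k) / B.len i k, fun k => ?_, fun k => ?_⟩
    · have hyk : y k ∈ Ioo (a i k) (b i k) := hy k (mem_univ k)
      simp only [a, b, mem_Ioo] at hyk
      rcases lt_or_gt_of_ne (hne k) with h | h
      · rw [abs_of_neg h] at hyk
        rw [mem_Ioo, lt_div_iff_of_neg h, div_lt_iff_of_neg h]
        constructor <;> linarith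
      · rw [abs_of_pos h] at hyk
        rw [mem_Ioo, lt_div_iff₀ h, div_lt_iff₀ h]
        constructor <;> linarith
    · rw [mul_div_cancel₀ _ (hne k)]
      ring
  have hdisj : (univ : Set B.ι).PairwiseDisjoint O := by
    intro i _ i' _ hne
    refine Set.disjoint_left.2 fun y hy hy' => ?_
    obtain ⟨t, ht, hyt⟩ := hO i y hy
    obtain ⟨u, hu, hyu⟩ := hO i' y hy'
    obtain ⟨k, -, hk⟩ := B.disj i i' hne t u ht hu
    exact hk ((hyt k).symm.trans (hyu k))
  have hsub : (⋃ i ∈ (Finset.univ : Finset B.ι), O i) ⊆ ⋃ p ∈ P, Q p := by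
    refine iUnion₂_subset fun i _ y hy => ?_
    obtain ⟨_, ⟨x, hxR, rfl⟩, hx⟩ := B.meets i
    obtain ⟨p, hp, hxp⟩ := hP x hxR
    refine mem_biUnion hp fun k _ => ?_
    obtain ⟨t, ht, hyt⟩ := hO i y hy
    obtain ⟨u, hu, hxu⟩ := hx k k.2
    have h1 : |y k - (x : EuclideanSpace ℝ (Fin d)) (σ k)| ≤ δ := by
      rw [hyt, hxu, add_sub_add_right_eq_sub, ← mul_sub, abs_mul]
      refine (mul_le_of_le_one_right (abs_nonneg _) ?_).trans (hlen i k).2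
      exact abs_le.2 ⟨by linarith [(ht k).1, hu.2], by linarith [(ht k).2, hu.1]⟩
    have h2 : |(x : EuclideanSpace ℝ (Fin d)) (σ k) - (p : EuclideanSpace ℝ (Fin d)) (σ k)| < 2 * δ :=
      (abs_sub_coord_le_dist _ _ _).trans_lt hxp
    rw [abs_le] at h1
    rw [abs_lt] at h2
    exact ⟨by linarith, by linarith⟩
  have hvolO : ∀ i, ENNReal.ofReal ((c * δ) ^ d) ≤ volume (O i) := by
    intro i
    simp only [O]
    rw [Real.volume_pi_Ioo, ENNReal.ofReal_pow (by positivity)]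
    calc ENNReal.ofReal (c * δ) ^ d = ∏ _k : Fin d, ENNReal.ofReal (c * δ) := by simp
      _ ≤ _ := Finset.prod_le_prod' fun k _ => ENNReal.ofReal_le_ofReal (by
          simp only [a, b]
          linarith [(hlen i k).1])
  have hvolQ : ∀ p, volume (Q p) = ENNReal.ofReal ((6 * δ) ^ d) := by
    intro p
    simp only [Q]
    rw [Real.volume_pi_Ioo, ENNReal.ofReal_pow (by positivity)]
    simp only [add_sub_sub_cancel]
    rw [Finset.prod_const, Finset.card_univ, Fintype.card_fin]
    congr 2
    ring
  have h : (Fintype.card B.ι : ℝ≥0∞) * ENNReal.ofReal ((c * δ) ^ d) ≤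
      P.card * ENNReal.ofReal ((6 * δ) ^ d) := by
    calc (Fintype.card B.ι : ℝ≥0∞) * ENNReal.ofReal ((c * δ) ^ d)
        = ∑ _i : B.ι, ENNReal.ofReal ((c * δ) ^ d) := by simp
      _ ≤ ∑ i : B.ι, volume (O i) := Finset.sum_le_sum fun i _ => hvolO i
      _ = volume (⋃ i ∈ (Finset.univ : Finset B.ι), O i) :=
          (measure_biUnion_finset (by simpa using hdisj) fun i _ =>
            MeasurableSet.univ_pi fun _ => measurableSet_Ioo).symm
      _ ≤ volume (⋃ p ∈ P, Q p) := measure_mono hsub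
      _ ≤ ∑ p ∈ P, volume (Q p) := measure_biUnion_finset_le _ _
      _ = _ := by simp [hvolQ]
  rw [hPcard, ← ENNReal.ofReal_natCast, ← ENNReal.ofReal_natCast,
    ← ENNReal.ofReal_mul (Nat.cast_nonneg _), ← ENNReal.ofReal_mul (Nat.cast_nonneg _)] at h
  exact (ENNReal.ofReal_le_ofReal_iff (by positivity)).1 h

/-- The factor `c ^ |b|` serves exponents of both signs, so the sign of the `β k` plays no role. -/
theorem rpow_bounds {r b : ℝ} (hc : 0 < c) (hδ : 0 < δ) (hr : c * δ ≤ r) (hrδ : r ≤ δ) :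
    c ^ |b| * δ ^ b ≤ r ^ b ∧ c ^ |b| * r ^ b ≤ δ ^ b := by
  have hcr : 0 < c * δ := mul_pos hc hδ
  have hr0 : 0 < r := hcr.trans_le hr
  have hc1 : c ≤ 1 := by
    have := hr.trans hrδ
    by_contra! h
    nlinarith
  have hcb : c ^ |b| ≤ 1 := Real.rpow_le_one hc.le hc1 (abs_nonneg b)
  rcases le_total 0 b with hb | hb
  · rw [abs_of_nonneg hb] at hcb ⊢
    have h1 := Real.rpow_le_rpow hcr.le hr hb
    have h2 := Real.rpow_le_rpow hr0.le hrδ hb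
    rw [Real.mul_rpow hc.le hδ.le] at h1
    exact ⟨h1, (mul_le_of_le_one_left (Real.rpow_nonneg hr0.le b) hcb).trans h2⟩
  · rw [abs_of_nonpos hb] at hcb ⊢
    have h1 := Real.rpow_le_rpow_of_nonpos hcr hr hb
    have h2 := Real.rpow_le_rpow_of_nonpos hr0 hrδ hb
    rw [Real.mul_rpow hc.le hδ.le] at h1
    refine ⟨(mul_le_of_le_one_left (Real.rpow_nonneg hδ.le b) hcb).trans h2, ?_⟩
    rw [Real.rpow_neg hc.le, inv_mul_le_iff₀ (Real.rpow_pos_of_pos hc b)]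
    exact h1

/-- Every summand of the mass is `δ ^ ∑ β` up to the factor `∏ c ^ |β k|`. -/
theorem BoxFamily.card_bounds (hc : 0 < c) (hδ : 0 < δ) {R : Set (EuclideanSpace ℝ (Fin d))}
    (B : BoxFamily σ β c d (fun _ => δ) R m) :
    (∏ k, c ^ |β k|) * (Fintype.card B.ι * δ ^ ∑ k, β k) ≤ m ∧
      (∏ k, c ^ |β k|) * m ≤ Fintype.card B.ι * δ ^ ∑ k, β k := by
  have hlen : ∀ i k, c * δ ≤ |B.len i k| ∧ |B.len i k| ≤ δ := fun i k =>
    ⟨B.le_len i k k.2, B.len_le i k k.2⟩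
  have hm : ∑ i, ∏ k : Fin d, |B.len i k| ^ β k = m := by
    simpa only [lowRanks_self] using B.mass
  rw [Real.rpow_sum_of_pos hδ]
  have hconst : (Fintype.card B.ι : ℝ) * ∏ k, δ ^ β k = ∑ _i : B.ι, ∏ k, δ ^ β k := by simp
  have hbounds := fun i k => rpow_bounds (b := β k) hc hδ (hlen i k).1 (hlen i k).2
  have hm' := hm.symm
  rw [hconst, Finset.mul_sum]
  constructor
  · refine (Finset.sum_le_sum fun i _ => ?_).trans hm.le
    rw [← Finset.prod_mul_distrib]
    exact Finset.prod_le_prod (fun k _ => by positivity) fun k _ => (hbounds i k).1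
  · refine (congrArg _ hm').le.trans ?_
    rw [Finset.mul_sum]
    refine Finset.sum_le_sum fun i _ => ?_
    rw [← Finset.prod_mul_distrib]
    exact Finset.prod_le_prod (fun k _ => by positivity) fun k _ => (hbounds i k).2

/-- Packing numbers of a set with approximate cubes at all small scales. -/
theorem exists_packing_bounds (σ : Equiv.Perm (Fin d)) (β : Fin d → ℝ) (hc : 0 < c) :
    ∃ M : ℝ, 0 < M ∧ ∀ (R : Set Φ.sponge) (m : ℝ),
      (∀ᶠ δ : ℝ in 𝓝[>] 0, Nonempty (BoxFamily σ β c d (fun _ => δ) (Subtype.val '' R) m)) →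
      ∀ᶠ δ : ℝ in 𝓝[>] 0, M⁻¹ * m ≤ ballPackingNumber δ R * δ ^ ∑ k, β k ∧
        ballPackingNumber δ R * δ ^ ∑ k, β k ≤ M * m := by
  set K : ℝ := ∏ k, c ^ |β k| with hK
  have hK0 : 0 < K := Finset.prod_pos fun k _ => Real.rpow_pos_of_pos hc _
  have hd0 : (0 : ℝ) < d + 1 := by positivity
  -- `M₁` comes from the volume comparison at scale `δ`; `M₂` comes from boxes of scale `δ / (d +
  -- 1)`, whose rescaling costs `(d + 1) ^ ∑ β`.
  let M₁ : ℝ := (6 / c) ^ d / K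
  let M₂ : ℝ := ((d : ℝ) + 1) ^ (∑ k, β k) / K
  have hM₁ : 0 < M₁ := by positivity
  refine ⟨max M₁ M₂, lt_max_of_lt_left hM₁, fun R m h => ?_⟩
  have htend : Tendsto (fun δ : ℝ => δ / (d + 1)) (𝓝[>] 0) (𝓝[>] 0) := by
    refine tendsto_nhdsWithin_iff.2 ⟨?_, ?_⟩
    · have : Tendsto (fun δ : ℝ => δ / (d + 1)) (𝓝 0) (𝓝 (0 / (d + 1))) :=
        tendsto_id.div_const _
      rw [zero_div] at this
      exact this.mono_left nhdsWithin_le_nhds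
    · filter_upwards [self_mem_nhdsWithin] with δ hδ
      exact div_pos hδ hd0
  filter_upwards [h, htend.eventually h, self_mem_nhdsWithin] with δ ⟨B⟩ ⟨B'⟩ hδ
  have hδ : 0 < δ := hδ
  have hδ' : 0 < δ / (d + 1) := div_pos hδ hd0
  have hpow : 0 < δ ^ ∑ k, β k := Real.rpow_pos_of_pos hδ _
  obtain ⟨-, h1⟩ := B.card_bounds hc hδ
  obtain ⟨h2, -⟩ := B'.card_bounds hc hδ'
  have hm : 0 ≤ m := le_trans (by positivity) h2
  rw [← hK] at h1 h2
  constructor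
  · have h3 := B.card_mul_le hc hδ
    have h4 : (Fintype.card B.ι : ℝ) ≤ (6 / c) ^ d * ballPackingNumber δ R := by
      rw [mul_pow, mul_pow, ← mul_assoc, ← mul_assoc, mul_le_mul_iff_left₀ (by positivity)] at h3
      rw [div_pow, div_mul_eq_mul_div, le_div_iff₀ (by positivity)]
      linarith
    calc (max M₁ M₂)⁻¹ * m ≤ M₁⁻¹ * m := by
          gcongr
          exact le_max_left _ _
      _ ≤ _ := by
          rw [inv_mul_le_iff₀ hM₁]
          simp only [M₁]
          rw [div_mul_eq_mul_div, le_div_iff₀ hK0, mul_comm m K]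
          refine h1.trans ?_
          rw [← mul_assoc]
          gcongr
  · calc _ ≤ (Fintype.card B'.ι : ℝ) * δ ^ ∑ k, β k := by
          gcongr
          exact B'.ballPackingNumber_le hδ
      _ ≤ M₂ * m := by
          rw [Real.div_rpow hδ.le hd0.le] at h2
          simp only [M₂]
          rw [div_mul_eq_mul_div, le_div_iff₀ hK0]
          have hp : 0 < ((d : ℝ) + 1) ^ ∑ k, β k := Real.rpow_pos_of_pos hd0 _
          rw [← mul_div_assoc, ← mul_div_assoc, div_le_iff₀ hp] at h2
          linarith
      _ ≤ max M₁ M₂ * m := by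
          gcongr
          exact le_max_right _ _

end DiagonalIFS

/-! ### Box dimension, components and conclusion -/

/-- The logarithm of `N_δ δ ^ β` stays bounded while `-log δ` tends to infinity, so `log N_δ / -log
δ` differs from `β` by a vanishing error. -/
theorem hasBoxDim_of_packing_bounds {X : Type*} [MetricSpace X] {β M : ℝ} (hM : 0 < M)
    (h : ∀ᶠ δ : ℝ in 𝓝[>] 0, M⁻¹ ≤ ballPackingNumber δ (univ : Set X) * δ ^ β ∧
      ballPackingNumber δ (univ : Set X) * δ ^ β ≤ M) : HasBoxDim X β := by
  have hlog : Tendsto (fun δ : ℝ => -Real.log δ) (𝓝[>] 0) atTop :=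
    tendsto_neg_atBot_atTop.comp Real.tendsto_log_nhdsGT_zero
  have herr : Tendsto (fun δ : ℝ => Real.log (ballPackingNumber δ (univ : Set X) * δ ^ β) /
      -Real.log δ) (𝓝[>] 0) (𝓝 0) := by
    refine squeeze_zero_norm' ?_ (hlog.const_div_atTop (Real.log M))
    filter_upwards [h, hlog.eventually_gt_atTop 0] with δ hδ hl
    rw [Real.norm_eq_abs, abs_div, abs_of_pos hl]
    have hpos := (inv_pos.2 hM).trans_le hδ.1
    gcongr
    refine abs_le.2 ⟨?_, Real.log_le_log hpos hδ.2⟩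
    rw [← Real.log_inv]
    exact Real.log_le_log (inv_pos.2 hM) hδ.1
  have hlim : Tendsto (fun δ : ℝ => Real.log (ballPackingNumber δ (univ : Set X)) / -Real.log δ)
      (𝓝[>] 0) (𝓝 β) := by
    have := herr.add_const β
    rw [zero_add] at this
    refine this.congr' ?_
    filter_upwards [h, hlog.eventually_gt_atTop 0, self_mem_nhdsWithin] with δ hδ hl hδ0
    have hδ0 : 0 < δ := hδ0
    have hpos := (inv_pos.2 hM).trans_le hδ.1
    have hN : (ballPackingNumber δ (univ : Set X) : ℝ) ≠ 0 := fun h0 => by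
      rw [h0, zero_mul] at hpos
      exact lt_irrefl _ hpos
    rw [Real.log_mul hN (Real.rpow_pos_of_pos hδ0 β).ne', Real.log_rpow hδ0]
    have hl' : Real.log δ ≠ 0 := fun h0 => by simp [h0] at hl
    field_simp
    ring
  have hE := (continuous_coe_real_ereal.tendsto β).comp hlim
  exact ⟨hE.liminf_eq, hE.limsup_eq⟩

theorem mem_of_dist_le_of_mem_epsComponents {X : Type*} [MetricSpace X] {ε : ℝ} {R : Set X}
    (hR : R ∈ epsComponents X ε) {x y : X} (hxy : dist x y ≤ ε) (hx : x ∈ R) : y ∈ R := by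
  obtain ⟨z, rfl⟩ := hR
  exact Relation.ReflTransGen.tail hx hxy

theorem isOpen_of_mem_epsComponents {X : Type*} [MetricSpace X] {ε : ℝ} (hε : 0 < ε) {R : Set X}
    (hR : R ∈ epsComponents X ε) : IsOpen R := by
  refine Metric.isOpen_iff.2 fun x hx => ⟨ε, hε, fun y hy => ?_⟩
  rw [Metric.mem_ball, dist_comm] at hy
  exact mem_of_dist_le_of_mem_epsComponents hR hy.le hx

namespace DiagonalIFS

variable {d : ℕ} {Φ : DiagonalIFS d} {σ : Equiv.Perm (Fin d)}

theorem bernoulliMeasure_eq_ofReal_mass {R : Set Φ.sponge} (hR : MeasurableSet R) :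
    Φ.bernoulliMeasure σ R = ENNReal.ofReal (Φ.mass σ (Subtype.val '' R)) := by
  rw [bernoulliMeasure, Measure.map_apply Φ.measurable_coding hR, mass, Measure.real,
    ENNReal.ofReal_toReal (measure_ne_top _ _)]
  refine congrArg (Φ.seqLaw σ) ?_
  ext ω
  simp

/-- Relatively measurable parts of the sponge with gaps of positive size around them have
approximate cubes at all small scales. -/
theorem eventually_nonempty_boxFamily (hd : 1 ≤ d) (hord : Φ.CoordinateOrdering σ)
    (hneat : Φ.NeatProjection σ) {c ρ : ℝ} (hc : 0 < c) (hρ0 : 0 < ρ) (hρ1 : ρ < 1)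
    (hb : ∀ a ∈ Φ.digits, ∀ i, c ≤ |(a i).slope| ∧ |(a i).slope| ≤ ρ) {R : Set Φ.sponge}
    (hR : MeasurableSet R) {ε : ℝ} (hε : 0 < ε) (hsat : ∀ x ∈ R, ∀ y, dist x y ≤ ε → y ∈ R) :
    ∀ᶠ δ : ℝ in 𝓝[>] 0, Nonempty (BoxFamily σ (Φ.exponents σ) c d (fun _ => δ)
      (Subtype.val '' R) (Φ.mass σ (Subtype.val '' R))) := by
  have hsub : Subtype.val '' R ⊆ Φ.sponge := by
    rintro _ ⟨x, -, rfl⟩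
    exact x.2
  -- Choose `n` so that cylinders of level `n`, of diameter at most `ρ ^ n` times that of the
  -- sponge, are shorter than the gap `ε`. The depth `n` then dictates the threshold `c ^ n` for
  -- `δ`.
  obtain ⟨n, hn⟩ := (((tendsto_pow_atTop_nhds_zero_of_lt_one hρ0.le hρ1).mul_const
    (Metric.diam Φ.sponge)).eventually_lt_const (by simpa using hε)).exists
  have hlt : ∀ᶠ δ : ℝ in 𝓝[>] 0, δ < c ^ n :=
    nhdsWithin_le_nhds (eventually_lt_nhds (pow_pos hc n))
  filter_upwards [hlt, self_mem_nhdsWithin] with δ hδ hδ0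
  have := nonempty_boxFamily_inter hd hord hneat hc hρ0 hρ1 hb
    (fun x hx y hy => Metric.dist_le_diam_of_mem Φ.isCompact_sponge.isBounded hx hy) n
    (Subtype.val '' R) (Φ.isCompact_sponge.isClosed.measurableSet.subtype_image hR)
    (fun x hx y hy hxy hxR => by
      obtain ⟨x, hxR, rfl⟩ := hxR
      exact ⟨⟨y, hy⟩, hsat x hxR ⟨y, hy⟩ (hxy.trans hn.le), rfl⟩)
    (fun _ => δ) (fun _ => hδ0) monotone_const (fun _ => hδ.le)
  rwa [inter_eq_right.2 hsub] at this

end DiagonalIFS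
theorem theorem4 {d : ℕ} (hd : 1 ≤ d) (Φ : DiagonalIFS d) (σ : Equiv.Perm (Fin d))
    (hord : Φ.CoordinateOrdering σ) (hneat : Φ.NeatProjection σ) :
    HasBoxDim Φ.sponge (∑ j, Φ.exponents σ j) ∧
      (IsTotallyDisconnected Φ.sponge → IsMinkowskiMeasure (Φ.bernoulliMeasure σ)) := by
  obtain ⟨c, ρ, hc, hρ0, hρ1, hb⟩ := Φ.exists_slope_bounds
  obtain ⟨M, hM, hbounds⟩ :=
    DiagonalIFS.exists_packing_bounds (Φ := Φ) (c := c) σ (Φ.exponents σ) hc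
  have hfam := fun {R : Set Φ.sponge} => DiagonalIFS.eventually_nonempty_boxFamily hd hord hneat hc
    hρ0 hρ1 hb (R := R)
  have hdim : HasBoxDim Φ.sponge (∑ j, Φ.exponents σ j) := by
    refine hasBoxDim_of_packing_bounds hM ?_
    -- The whole sponge is saturated at every distance, so `ε = 1` is arbitrary; its mass is `1`.
    have h := hbounds univ _ (hfam MeasurableSet.univ zero_lt_one fun _ _ y _ => mem_univ y)
    rw [Φ.mass_of_sponge_subset σ (by simp)] at h
    simpa only [mul_one] using h
  refine ⟨hdim, fun _ => ⟨_, hdim, M, hM, fun ε hε R hR => ?_⟩⟩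
  have hRm := (isOpen_of_mem_epsComponents hε hR).measurableSet
  filter_upwards [hbounds R _ (hfam hRm hε fun x hx y hxy =>
    mem_of_dist_le_of_mem_epsComponents hR hxy hx)] with δ hδ
  rw [DiagonalIFS.bernoulliMeasure_eq_ofReal_mass hRm, ← ENNReal.ofReal_mul (inv_nonneg.2 hM.le),
    ← ENNReal.ofReal_mul hM.le]
  exact ⟨ENNReal.ofReal_le_ofReal hδ.1, ENNReal.ofReal_le_ofReal hδ.2⟩
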